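/- Let $K$ be a field, $Q$ a quiver, $\mathcal B$ the set of finite directed paths in $Q$ (vertices are paths of length $0$), and $\succ$ an admissible order on $\mathcal B$, that is, a well-order such that: $p\succ q$ implies $pr\succ qr$ and $sp\succ sq$ whenever these products are nonzero; and $p\succeq q$ whenever $q$ is a subpath of $p$. The tip of a nonzero $x\in KQ$ is the $\succ$-largest path with nonzero coefficient in $x$, and $\operatorname{tip}(I)$ is the set of tips of the nonzero elements of $I$. For an ideal $I$ of $KQ$, let $\mathcal T_I$ be the unique minimal set of paths generating $\langle\operatorname{tip}(I)\rangle$; the reduced Gröbner basis of $I$ is the set of all $g\in I$ such that $t-g\in\operatorname{Span}_K(\mathcal B\setminus\operatorname{tip}(I))$ for some $t\in\mathcal T_I$. Let $\mathcal T$ be a finite set of paths of length at least $2$ that is tip-reduced (no element of $\mathcal T$ is a subpath of a different element). Let $\mathcal N$ be the set of paths that have no subpath in $\mathcal T$. For $t\in\mathcal T$ let $\mathcal N(t)=\{n\in\mathcal N\mid n \text{ parallel to } t,\ t\succ n\}$. Suppose that each $\mathcal N(t)$ is finite, and put $D=\sum_{t\in\mathcal T}|\mathcal N(t)|$. Let $$\mathcal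 V_{\mathcal T}=\{(c_{t,n})\in K^D \mid \mathcal G=\{t-\textstyle\sum_{n\in\mathcal N(t)}c_{t,n}n \mid t\in\mathcal T\}\text{ is the reduced Gröbner basis of }\langle\mathcal G\rangle\}.$$ Let $R=K[x_{t,n}\mid t\in\mathcal T,\ n\in\mathcal N(t)]$, let $L$ be its field of fractions, and let $\mathcal H=\{h_t\mid t\in\mathcal T\}\subset LQ$ with $h_t=t-\sum_{n\in\mathcal N(t)}x_{t,n}n$. For $t,t'\in\mathcal T$ and paths $p,q$ with $tp=qt'$, $\ell(q)\ge 1$ and $1\le\ell(p)<\ell(t')$, the overlap relation is $\mathbf o(h_t,h_{t'},p,q)=h_tp-qh_{t'}$. A simple reduction by $\mathcal H$ replaces $x\in LQ$ by $x-\alpha\, r h_t s$, where $rts$ is a path ($t\in\mathcal T$, $r,s\in\mathcal B$) whose coefficient $\alpha$ in $x$ is nonzero; a complete reduction is a finite sequence of simple reductions whose last element admits no further simple reduction. Then: 1. $\mathcal V_{\mathcal T}\subseteq K^D$ is an affine algebraic variety, i.e. the common zero set of finitely many polynomials. 2. Every overlap relation of elements of $\mathcal H$ has a complete reduction by $\mathcal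 H$, and every complete reduction of such an overlap relation $\mathbf o$ has the form $\sum_{n\in\mathcal N}f^*_{\mathbf o,n}\,n$ (a finite sum) with $f^*_{\mathbf o,n}\in R$. 3. For every choice of one complete reduction for each overlap relation $\mathbf o=\mathbf o(h_t,h_{t'},p,q)$, $\mathcal V_{\mathcal T}$ is exactly the set of common zeros in $K^D$ of all the resulting polynomials $f^*_{\mathbf o,n}$. -/

import Mathlib

namespace QuiverVariety

universe u v w

/-- A finite directed path in a quiver, with its origin and terminus. Vertices are the paths of
length zero. The type `QPath V` is the set `ℬ` of all finite directed paths. -/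
@[ext]
structure QPath (V : Type u) [Quiver.{v} V] where
  /-- the origin vertex -/
  src : V
  /-- the terminus vertex -/
  tgt : V
  /-- the underlying path -/
  path : Quiver.Path src tgt

namespace QPath

variable {V : Type u} [Quiver.{v} V]

/-- The length (number of arrows) of a path. -/
def length (p : QPath V) : ℕ := p.path.length

/-- Concatenation: first `p`, then `q`. -/
def comp (p q : QPath V) (h : p.tgt = q.src) : QPath V :=
  ⟨p.src, q.tgt, p.path.comp (Quiver.Path.cast h.symm rfl q.path)⟩

theorem comp_assoc (p q r : QPath V) (h : p.tgt = q.src) (h' : q.tgt = r.src) :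
    (p.comp q h).comp r h' = p.comp (q.comp r h') h := by
  obtain ⟨a, b, p⟩ := p
  obtain ⟨c, d, q⟩ := q
  obtain ⟨e, f, r⟩ := r
  cases h
  cases h'
  simp [comp]

/-- `IsComp p q z`: the product `p q` is nonzero (the paths are composable) and equals `z`. -/
def IsComp (p q z : QPath V) : Prop := ∃ h : p.tgt = q.src, p.comp q h = z

/-- `IsComp₃ r t s p`: the product `r t s` is nonzero and equals `p`. -/
def IsComp₃ (r t s p : QPath V) : Prop := ∃ z, IsComp r t z ∧ IsComp z s p

/-- `t` is a subpath of `p`: `p = r t s` for some paths `r`, `s`. -/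
def IsSubpath (t p : QPath V) : Prop := ∃ r s, IsComp₃ r t s p

/-- Two paths are parallel if they have the same origin and the same terminus. -/
def Parallel (p q : QPath V) : Prop := p.src = q.src ∧ p.tgt = q.tgt

end QPath

/-- The path algebra `RQ` of a quiver: formal finite `R`-linear combinations of paths. The product
of two paths is their concatenation if they are composable and `0` otherwise. -/
def PathAlgebra (R : Type w) [CommRing R] (V : Type u) [Quiver.{v} V] := QPath V →₀ R

namespace PathAlgebra

section Algebra

variable {R : Type w} [CommRing R] {V : Type u} [Quiver.{v} V]

noncomputable instance : AddCommGroup (PathAlgebra R V) :=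
  inferInstanceAs (AddCommGroup (QPath V →₀ R))

noncomputable instance : Module R (PathAlgebra R V) :=
  inferInstanceAs (Module R (QPath V →₀ R))

/-- The element `a p` of the path algebra, for a path `p` and a scalar `a`. -/
noncomputable def single (p : QPath V) (a : R) : PathAlgebra R V := Finsupp.single p a

/-- A path as an element of the path algebra. -/
noncomputable def mono (R : Type w) [CommRing R] (p : QPath V) : PathAlgebra R V := single p 1

/-- The coefficient of the path `p` in `x`. -/
def coeff (x : PathAlgebra R V) (p : QPath V) : R := (show QPath V →₀ R from x) p

open Classical in
/-- The product of two paths in the path algebra. -/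
noncomputable def monoMul (R : Type w) [CommRing R] (p q : QPath V) : PathAlgebra R V :=
  if h : p.tgt = q.src then mono R (p.comp q h) else 0

/-- Multiplication of the path algebra: the bilinear extension of the product of paths. -/
noncomputable def mulHom : PathAlgebra R V →ₗ[R] PathAlgebra R V →ₗ[R] PathAlgebra R V :=
  Finsupp.lift (PathAlgebra R V →ₗ[R] PathAlgebra R V) R (QPath V) fun p =>
    Finsupp.lift (PathAlgebra R V) R (QPath V) fun q => monoMul R p q

noncomputable instance : Mul (PathAlgebra R V) := ⟨fun x y => mulHom x y⟩

theorem mulHom_mono (p q : QPath V) : mulHom (mono R p) (mono R q) = monoMul R p q := by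
  have h1 : mulHom (mono R p) = Finsupp.lift (PathAlgebra R V) R (QPath V)
      fun q => monoMul R p q := by
    refine (Finsupp.lift_apply _ _ _ _ _).trans ?_
    refine (Finsupp.sum_single_index ?_).trans ?_
    · exact zero_smul R _
    · exact one_smul R _
  rw [h1]
  refine (Finsupp.lift_apply _ _ _ _ _).trans ?_
  refine (Finsupp.sum_single_index ?_).trans ?_
  · exact zero_smul R _
  · exact one_smul R _

theorem mono_mul_mono (p q : QPath V) : mono R p * mono R q = monoMul R p q := mulHom_mono p q

theorem hom_ext {M : Type*} [AddCommGroup M] [Module R M] {f g : PathAlgebra R V →ₗ[R] M}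
    (h : ∀ p, f (mono R p) = g (mono R p)) : f = g :=
  Finsupp.lhom_ext' fun p => LinearMap.ext_ring (h p)

theorem mulHom_assoc (x y z : PathAlgebra R V) :
    mulHom (mulHom x y) z = mulHom x (mulHom y z) := by
  have key : (LinearMap.llcomp R (PathAlgebra R V) (PathAlgebra R V)
        (PathAlgebra R V →ₗ[R] PathAlgebra R V) mulHom).comp mulHom =
      ((LinearMap.llcomp R (PathAlgebra R V) (PathAlgebra R V →ₗ[R] PathAlgebra R V)
        (PathAlgebra R V →ₗ[R] PathAlgebra R V)).flip mulHom).comp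
        ((LinearMap.llcomp R (PathAlgebra R V) (PathAlgebra R V) (PathAlgebra R V)).comp
          mulHom) := by
    refine hom_ext fun p => hom_ext fun q => hom_ext fun r => ?_
    change mulHom (mulHom (mono R p) (mono R q)) (mono R r) =
      mulHom (mono R p) (mulHom (mono R q) (mono R r))
    rw [mulHom_mono, mulHom_mono]
    by_cases h : p.tgt = q.src
    · by_cases h' : q.tgt = r.src
      · have e1 : monoMul R p q = mono R (p.comp q h) := dif_pos h
        have e2 : monoMul R q r = mono R (q.comp r h') := dif_pos h'
        rw [e1, e2, mulHom_mono, mulHom_mono]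
        have e3 : monoMul R (p.comp q h) r = mono R ((p.comp q h).comp r h') := dif_pos h'
        have e4 : monoMul R p (q.comp r h') = mono R (p.comp (q.comp r h') h) := dif_pos h
        rw [e3, e4, QPath.comp_assoc]
      · have e1 : monoMul R p q = mono R (p.comp q h) := dif_pos h
        have e2 : monoMul R q r = 0 := dif_neg h'
        have e3 : monoMul R (p.comp q h) r = 0 := dif_neg h'
        rw [e1, e2, mulHom_mono, e3, map_zero]
    · have e1 : monoMul R p q = 0 := dif_neg h
      rw [e1, map_zero, LinearMap.zero_apply]
      by_cases h' : q.tgt = r.src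
      · have e2 : monoMul R q r = mono R (q.comp r h') := dif_pos h'
        have e4 : monoMul R p (q.comp r h') = 0 := dif_neg h
        rw [e2, mulHom_mono, e4]
      · have e2 : monoMul R q r = 0 := dif_neg h'
        rw [e2, map_zero]
  exact LinearMap.congr_fun (LinearMap.congr_fun (LinearMap.congr_fun key x) y) z

/-- The path algebra is an associative ring (with unit when there are finitely many vertices). -/
noncomputable instance : NonUnitalRing (PathAlgebra R V) where
  left_distrib x y z := map_add (mulHom x) y z
  right_distrib x y z := by
    change mulHom (x + y) z = mulHom x z + mulHom y z
    rw [map_add, LinearMap.add_apply]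
  zero_mul x := by
    change mulHom 0 x = 0
    rw [map_zero, LinearMap.zero_apply]
  mul_zero x := map_zero (mulHom x)
  mul_assoc x y z := mulHom_assoc x y z

/-- Extension of scalars, applied to each coefficient. -/
noncomputable def mapCoeff {S : Type*} [CommRing S] (φ : R →+* S) (x : PathAlgebra R V) :
    PathAlgebra S V :=
  Finsupp.mapRange φ (map_zero φ) x

end Algebra

end PathAlgebra

open PathAlgebra

section Groebner

variable {V : Type u} [Quiver.{v} V]

/-- An admissible order on the set of paths; `lt q p` means `p ≻ q`. It is a well-order, compatible
with multiplication on both sides as long as the products are nonzero, and a path is `⪰` each of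
its subpaths. -/
structure IsAdmissibleOrder (lt : QPath V → QPath V → Prop) : Prop where
  wellOrder : IsWellOrder (QPath V) lt
  mul_right : ∀ p q r pr qr : QPath V, lt q p → QPath.IsComp p r pr → QPath.IsComp q r qr →
    lt qr pr
  mul_left : ∀ p q s sp sq : QPath V, lt q p → QPath.IsComp s p sp → QPath.IsComp s q sq →
    lt sq sp
  subpath : ∀ p q : QPath V, QPath.IsSubpath q p → q = p ∨ lt q p

variable (lt : QPath V → QPath V → Prop) {R : Type w} [CommRing R]

/-- `t` is the tip of `x` (in particular `x ≠ 0`): the largest path with nonzero coefficient. -/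
def IsTip (x : PathAlgebra R V) (t : QPath V) : Prop :=
  coeff x t ≠ 0 ∧ ∀ q, coeff x q ≠ 0 → q = t ∨ lt q t

/-- The set `tip(X)` of the tips of the nonzero elements of `X`. -/
def tips (X : Set (PathAlgebra R V)) : Set (QPath V) := {t | ∃ x ∈ X, IsTip lt x t}

/-- The two-sided ideal generated by a set of paths. -/
noncomputable def monomialIdeal (R : Type w) [CommRing R] (T : Set (QPath V)) :
    TwoSidedIdeal (PathAlgebra R V) :=
  TwoSidedIdeal.span (mono R '' T)

/-- `T` is the unique minimal set of paths generating the ideal `⟨tip(I)⟩`. -/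
def IsMinimalTipGenerators (I : TwoSidedIdeal (PathAlgebra R V)) (T : Set (QPath V)) : Prop :=
  IsLeast {S : Set (QPath V) | monomialIdeal R S = monomialIdeal R (tips lt (I : Set (PathAlgebra R V)))} T

/-- `G` is the reduced Gröbner basis of the ideal `I`. With `T` the minimal set of paths generating
`⟨tip(I)⟩`, it consists of the elements `g ∈ I` such that `t = g + N` for some `t ∈ T` and some
linear combination `N` of paths outside `tip(I)`. -/
def IsReducedGroebnerBasis (G : Set (PathAlgebra R V)) (I : TwoSidedIdeal (PathAlgebra R V)) :
    Prop :=
  ∃ T, IsMinimalTipGenerators lt I T ∧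
    G = {g | g ∈ I ∧ ∃ t ∈ T, ∃ N ∈ Submodule.span R (mono R '' (tips lt (I : Set (PathAlgebra R V)))ᶜ),
      mono R t = g + N}

/-- `x →_F y`, a simple reduction: there are `f ∈ F` with tip `t` and a path `p = r t s` that has
nonzero coefficient in `x`, and `y = β x - α r f s`, where `β` is the coefficient of `t` in `f` and
`α` is the coefficient of `p` in `x`. -/
def SimpleReduction (F : Set (PathAlgebra R V)) (x y : PathAlgebra R V) : Prop :=
  ∃ f ∈ F, ∃ t r s p, IsTip lt f t ∧ QPath.IsComp₃ r t s p ∧ coeff x p ≠ 0 ∧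
    y = coeff f t • x - coeff x p • (mono R r * f * mono R s)

/-- `x ⇒_F y`, a complete reduction: a finite sequence of simple reductions leads from `x` to `y`,
and `y = 0` or `y` has no simple reduction. -/
def CompleteReduction (F : Set (PathAlgebra R V)) (x y : PathAlgebra R V) : Prop :=
  Relation.ReflTransGen (SimpleReduction lt F) x y ∧ (y = 0 ∨ ∀ z, ¬ SimpleReduction lt F y z)

/-- `o` is the overlap relation `o(x, y, m, n) = β x m - α n y`. Here `t` is the tip of `x` with
coefficient `α`, `t'` is the tip of `y` with coefficient `β`, and `t m = n t'`, where `n` has length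
at least one and `m` has length at least one and less than the length of `t'`. -/
def IsOverlapRelation (x y : PathAlgebra R V) (m n : QPath V) (o : PathAlgebra R V) : Prop :=
  ∃ t t' z, IsTip lt x t ∧ IsTip lt y t' ∧ QPath.IsComp t m z ∧ QPath.IsComp n t' z ∧
    1 ≤ n.length ∧ 1 ≤ m.length ∧ m.length < t'.length ∧
    o = coeff y t' • (x * mono R m) - coeff x t • (mono R n * y)

/-- A set of paths is tip-reduced if no element is a subpath of a different element. -/
def IsTipReduced (T : Set (QPath V)) : Prop :=
  ∀ s ∈ T, ∀ t ∈ T, s ≠ t → ¬ QPath.IsSubpath s t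

/-- The set `𝒩` of the paths that have no element of `T` as a subpath. -/
def nontips (T : Set (QPath V)) : Set (QPath V) := {p | ∀ t ∈ T, ¬ QPath.IsSubpath t p}

/-- The set `𝒩(t) = {n ∈ 𝒩 | n ∥ t, t ≻ n}`. -/
def nontipsBelow (T : Set (QPath V)) (t : QPath V) : Set (QPath V) :=
  {n | n ∈ nontips T ∧ QPath.Parallel n t ∧ lt n t}

/-- The index set of the coordinates: the pairs `(t, n)` with `t ∈ T` and `n ∈ 𝒩(t)`. -/
abbrev CoordIndex (T : Set (QPath V)) := (t : T) × nontipsBelow lt T (t : QPath V)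

/-- The element `t - ∑_{n ∈ 𝒩(t)} c_{t,n} n`, where `𝒩(t)` is meant to be finite. -/
noncomputable def tailElement (T : Set (QPath V)) (c : CoordIndex lt T → R) (t : T) :
    PathAlgebra R V :=
  mono R (t : QPath V) - ∑ᶠ n : nontipsBelow lt T (t : QPath V), single (n : QPath V) (c ⟨t, n⟩)

/-- The set `𝒱_T ⊆ K^D` of all `c` for which `G = {t - ∑ c_{t,n} n | t ∈ T}` is the reduced Gröbner
basis of the ideal `⟨G⟩` of `KQ`. -/
def varietyOf (K : Type w) [Field K] (T : Set (QPath V)) : Set (CoordIndex lt T → K) :=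
  {c | IsReducedGroebnerBasis lt (Set.range (tailElement lt T c))
    (TwoSidedIdeal.span (Set.range (tailElement lt T c)))}

/-- The polynomial ring `K[x_{t,n} | t ∈ T, n ∈ 𝒩(t)]`. -/
abbrev CoordRing (K : Type w) [Field K] (T : Set (QPath V)) := MvPolynomial (CoordIndex lt T) K

/-- The field of rational functions `K(x_{t,n} | t ∈ T, n ∈ 𝒩(t))`. -/
abbrev CoordField (K : Type w) [Field K] (T : Set (QPath V)) := FractionRing (CoordRing lt K T)

/-- The generic element `h_t = t - ∑_{n ∈ 𝒩(t)} x_{t,n} n`, with coefficients in the field of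
rational functions. -/
noncomputable def genericElement (K : Type w) [Field K] (T : Set (QPath V)) :
    T → PathAlgebra (CoordField lt K T) V :=
  tailElement lt T fun i => algebraMap (CoordRing lt K T) (CoordField lt K T) (MvPolynomial.X i)

end Groebner

/-- A subset of the affine space `K^σ`, with `σ` finite, is an affine algebraic variety if it is the
common zero set of finitely many polynomials. Irreducibility is not required. -/
def IsAffineVariety {K : Type*} [Field K] {σ : Type*} (Z : Set (σ → K)) : Prop :=
  Finite σ ∧ ∃ S : Finset (MvPolynomial σ K), Z = {c | ∀ f ∈ S, MvPolynomial.eval c f = 0}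

end QuiverVariety

open QuiverVariety PathAlgebra

/-! Let `g_t` be the element with tip `t` and coordinates `c`. By `mem_varietyOf_iff`, `c` lies in
the variety exactly when the ideal generated by the `g_t` contains no nonzero combination of paths
in `𝒩`. This is decided by overlaps, as in Bergman's diamond lemma.

The central object is `sandwichSpan c (lt · z)`, the span of the products `r g_t s` whose leading
path `r t s` is smaller than `z`. If each overlap with common multiple `z` lies in this span, then
any two products with the same leading path agree modulo smaller ones (`sandwich_sub_sandwich_mem`).
Well-founded induction on a bound for the leading paths then removes every element supported on `𝒩`
(`eq_zero_of_mem_span_of_overlapsResolvable`).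

Polynomiality holds because every `h_t` has tip coefficient 1: reducing never divides, so a
reduction over the fraction field lifts to the polynomial ring (`exists_lift_of_reduction`). The
lift also records that the overlap minus its remainder `f` lies in the span of products below `z`.
That membership survives evaluation at any `c`, whereas the chain of reductions may not, since
coefficients can vanish. The evaluated remainder `f(c)` is therefore supported on `𝒩` and congruent
to the overlap of the `g_t`. If `c` is in the variety, `f(c)` lies in the ideal and is zero; if
every `f(c)` is zero, all overlaps are resolvable (`varietyOf_eq_zeroLocus`). Hilbert's basis
theorem supplies the finite set of equations. -/

namespace QuiverVariety

universe u v w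

/-! ### Factorizations of paths and subpaths -/

namespace QPath

variable {V : Type u} [Quiver.{v} V]

theorem _root_.Quiver.Path.exists_comp_of_length_le {x y a b : V} (p : Quiver.Path a x)
    (q : Quiver.Path x b) (p' : Quiver.Path a y) (q' : Quiver.Path y b)
    (h : p.comp q = p'.comp q') (hl : p.length ≤ p'.length) :
    ∃ e : Quiver.Path x y, p' = p.comp e ∧ q = e.comp q' := by
  induction q' with
  | nil => exact ⟨q, h.symm, rfl⟩
  | cons q' f ih =>
    cases q with
    | nil =>
      have := congrArg Quiver.Path.length h
      simp only [Quiver.Path.comp_nil, Quiver.Path.length_comp, Quiver.Path.length_cons] at this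
      omega
    | cons q g =>
      rw [Quiver.Path.comp_cons, Quiver.Path.comp_cons] at h
      injection h with h1 h2 h3 h4
      subst h1
      obtain ⟨e, he, he'⟩ := ih q (eq_of_heq h3)
      exact ⟨e, he, by rw [he', eq_of_heq h4, Quiver.Path.comp_cons]⟩

/-- The path of length zero at a vertex. -/
def vertex (x : V) : QPath V := ⟨x, x, Quiver.Path.nil⟩

theorem isComp_mk {a b c : V} (p : Quiver.Path a b) (q : Quiver.Path b c) :
    IsComp (⟨a, b, p⟩ : QPath V) ⟨b, c, q⟩ ⟨a, c, p.comp q⟩ := ⟨rfl, rfl⟩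

theorem vertex_isComp (p : QPath V) : IsComp (vertex p.src) p p := by
  obtain ⟨a, b, p⟩ := p
  exact ⟨rfl, by simp [comp, vertex]⟩

theorem isComp_vertex (p : QPath V) : IsComp p (vertex p.tgt) p := by
  obtain ⟨a, b, p⟩ := p
  exact ⟨rfl, by simp [comp, vertex]⟩

namespace IsComp

variable {p q r z w : QPath V}

theorem length_eq (h : IsComp p q z) : z.length = p.length + q.length := by
  obtain ⟨a, b, p⟩ := p
  obtain ⟨c, d, q⟩ := q
  obtain ⟨h, rfl⟩ := h
  cases h
  simp [comp, length]

theorem tgt_eq_src (h : IsComp p q z) : p.tgt = q.src := h.1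

theorem src_eq (h : IsComp p q z) : z.src = p.src := by
  obtain ⟨h, rfl⟩ := h
  rfl

theorem tgt_eq (h : IsComp p q z) : z.tgt = q.tgt := by
  obtain ⟨h, rfl⟩ := h
  rfl

theorem unique (h : IsComp p q z) (h' : IsComp p q w) : z = w := by
  obtain ⟨h, rfl⟩ := h
  obtain ⟨h', rfl⟩ := h'
  rfl

theorem assoc (h : IsComp p q z) (h' : IsComp z r w) : ∃ y, IsComp q r y ∧ IsComp p y w := by
  obtain ⟨h, rfl⟩ := h
  obtain ⟨h', rfl⟩ := h'
  exact ⟨_, ⟨h', rfl⟩, ⟨h, (comp_assoc p q r h h').symm⟩⟩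

theorem assoc' (h : IsComp q r z) (h' : IsComp p z w) : ∃ y, IsComp p q y ∧ IsComp y r w := by
  obtain ⟨h, rfl⟩ := h
  obtain ⟨h', rfl⟩ := h'
  exact ⟨_, ⟨h', rfl⟩, ⟨h, comp_assoc p q r h' h⟩⟩

/-- Two factorizations of a path have a common refinement. -/
theorem exists_refinement {p' q' : QPath V} (h : IsComp p q z) (h' : IsComp p' q' z)
    (hl : p.length ≤ p'.length) : ∃ e, IsComp p e p' ∧ IsComp e q' q := by
  obtain ⟨a, b, p⟩ := p
  obtain ⟨c, d, q⟩ := q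
  obtain ⟨a', b', p'⟩ := p'
  obtain ⟨c', d', q'⟩ := q'
  obtain ⟨h, rfl⟩ := h
  obtain ⟨h', h2⟩ := h'
  cases h
  cases h'
  obtain rfl : a' = a := congrArg src h2
  obtain rfl : d' = d := congrArg tgt h2
  have h3 : p'.comp q' = p.comp q := by simpa [comp] using h2
  obtain ⟨e, rfl, rfl⟩ := Quiver.Path.exists_comp_of_length_le _ _ _ _ h3.symm hl
  exact ⟨⟨_, _, e⟩, isComp_mk _ _, isComp_mk _ _⟩

theorem eq_of_length_left (h : IsComp p q z) (hp : p.length = 0) : q = z := by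
  obtain ⟨a, b, p⟩ := p
  obtain rfl := Quiver.Path.eq_of_length_zero p hp
  obtain rfl := Quiver.Path.eq_nil_of_length_zero p hp
  have h1 : a = q.src := h.tgt_eq_src
  subst h1
  exact (vertex_isComp q).unique h

theorem eq_of_length_right (h : IsComp p q z) (hq : q.length = 0) : p = z := by
  obtain ⟨a, b, q⟩ := q
  obtain rfl := Quiver.Path.eq_of_length_zero q hq
  obtain rfl := Quiver.Path.eq_nil_of_length_zero q hq
  have h1 : p.tgt = a := h.tgt_eq_src
  subst h1
  exact (isComp_vertex p).unique h

theorem left_cancel (h : IsComp p q z) (h' : IsComp p r z) : q = r := by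
  obtain ⟨e, he, he'⟩ := h.exists_refinement h' le_rfl
  have := he.length_eq
  exact (he'.eq_of_length_left (by omega)).symm

theorem right_cancel (h : IsComp p r z) (h' : IsComp q r z) : p = q := by
  have h1 := h.length_eq
  have h2 := h'.length_eq
  obtain ⟨e, he, he'⟩ := h.exists_refinement h' (by omega)
  have := he.length_eq
  exact he.eq_of_length_right (by omega)

end IsComp

theorem IsComp.exists_of_eq {p q : QPath V} (h : p.tgt = q.src) : ∃ z, IsComp p q z := ⟨_, h, rfl⟩

namespace IsComp₃

variable {r t s p q w : QPath V}

theorem unique (h : IsComp₃ r t s p) (h' : IsComp₃ r t s q) : p = q := by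
  obtain ⟨z, h1, h2⟩ := h
  obtain ⟨z', h1', h2'⟩ := h'
  obtain rfl := h1.unique h1'
  exact h2.unique h2'

theorem cancel (h : IsComp₃ r t s p) (h' : IsComp₃ r q s p) : t = q := by
  obtain ⟨z, h1, h2⟩ := h
  obtain ⟨z', h1', h2'⟩ := h'
  obtain rfl := h2.right_cancel h2'
  exact h1.left_cancel h1'

theorem length_eq (h : IsComp₃ r t s p) : p.length = r.length + t.length + s.length := by
  obtain ⟨z, h1, h2⟩ := h
  rw [h2.length_eq, h1.length_eq]

/-- Composability sees only endpoints. This keeps the tail terms of `r g_t s` nonzero along with `r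
t s`. -/
theorem of_parallel (h : IsComp₃ r t s p) (hq : Parallel q t) : ∃ w, IsComp₃ r q s w := by
  obtain ⟨z, h1, h2⟩ := h
  obtain ⟨y, hy⟩ := IsComp.exists_of_eq (p := r) (q := q) (h1.tgt_eq_src.trans hq.1.symm)
  obtain ⟨w, hw⟩ := IsComp.exists_of_eq (p := y) (q := s)
    (by rw [hy.tgt_eq, hq.2, ← h1.tgt_eq, h2.tgt_eq_src])
  exact ⟨w, y, hy, hw⟩

theorem parallel (h : IsComp₃ r t s p) (h' : IsComp₃ r q s w) : Parallel w p := by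
  obtain ⟨z, h1, h2⟩ := h
  obtain ⟨z', h1', h2'⟩ := h'
  exact ⟨by rw [h2'.src_eq, h1'.src_eq, h2.src_eq, h1.src_eq], by rw [h2'.tgt_eq, h2.tgt_eq]⟩

theorem right_assoc (h : IsComp₃ r t s p) : ∃ z, IsComp t s z ∧ IsComp r z p := by
  obtain ⟨z, h1, h2⟩ := h
  exact h1.assoc h2

theorem of_right_assoc {z : QPath V} (h : IsComp t s z) (h' : IsComp r z p) : IsComp₃ r t s p :=
  h.assoc' h'

theorem trans {r' t' s' : QPath V} (h : IsComp₃ r t s p) (h' : IsComp₃ r' t' s' t) :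
    ∃ r'' s'', IsComp r r' r'' ∧ IsComp s' s s'' ∧ IsComp₃ r'' t' s'' p := by
  obtain ⟨z, h1, h2⟩ := h
  obtain ⟨z', h1', h2'⟩ := h'
  obtain ⟨y, h3, h4⟩ := h2'.assoc' h1
  obtain ⟨x, h5, h6⟩ := h1'.assoc' h3
  obtain ⟨s'', h7, h8⟩ := h4.assoc h2
  exact ⟨x, s'', h5, h7, y, h6, h8⟩

end IsComp₃

theorem isComp₃_vertex (p : QPath V) : IsComp₃ (vertex p.src) p (vertex p.tgt) p :=
  ⟨p, vertex_isComp p, isComp_vertex p⟩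

theorem IsComp.isSubpath_left {p q z : QPath V} (h : IsComp p q z) : IsSubpath p z :=
  ⟨vertex p.src, q, p, vertex_isComp p, h⟩

theorem IsComp.isSubpath_right {p q z : QPath V} (h : IsComp p q z) : IsSubpath q z :=
  ⟨p, vertex z.tgt, z, h, isComp_vertex z⟩

namespace IsSubpath

variable {p q r : QPath V}

theorem refl (p : QPath V) : IsSubpath p p := ⟨_, _, isComp₃_vertex p⟩

theorem trans (h : IsSubpath p q) (h' : IsSubpath q r) : IsSubpath p r := by
  obtain ⟨a, b, h⟩ := h
  obtain ⟨c, d, h'⟩ := h'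
  obtain ⟨x, y, -, -, h3⟩ := h'.trans h
  exact ⟨x, y, h3⟩

theorem length_le (h : IsSubpath p q) : p.length ≤ q.length := by
  obtain ⟨a, b, h⟩ := h
  have := h.length_eq
  omega

theorem eq_of_length_le (h : IsSubpath p q) (hl : q.length ≤ p.length) : p = q := by
  obtain ⟨a, b, h⟩ := h
  have := h.length_eq
  obtain ⟨z, h1, h2⟩ := h
  rw [h1.eq_of_length_left (by omega), h2.eq_of_length_right (by omega)]

theorem antisymm (h : IsSubpath p q) (h' : IsSubpath q p) : p = q :=
  h.eq_of_length_le h'.length_le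

end IsSubpath

end QPath

open QPath

/-! ### Admissible orders -/

namespace IsAdmissibleOrder

variable {V : Type u} [Quiver.{v} V] {lt : QPath V → QPath V → Prop}

theorem irrefl (hlt : IsAdmissibleOrder lt) (p : QPath V) : ¬ lt p p :=
  have := hlt.wellOrder
  irrefl_of lt p

theorem trans (hlt : IsAdmissibleOrder lt) {p q r : QPath V} (h : lt p q) (h' : lt q r) : lt p r :=
  have := hlt.wellOrder
  trans_of lt h h'

theorem wf (hlt : IsAdmissibleOrder lt) : WellFounded lt :=
  have := hlt.wellOrder
  IsWellFounded.wf

theorem total (hlt : IsAdmissibleOrder lt) (p q : QPath V) : lt p q ∨ p = q ∨ lt q p :=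
  have := hlt.wellOrder
  trichotomous_of lt p q

theorem isComp₃ (hlt : IsAdmissibleOrder lt) {r s p q p' q' : QPath V} (h : lt q p)
    (hp : IsComp₃ r p s p') (hq : IsComp₃ r q s q') : lt q' p' := by
  obtain ⟨z, h1, h2⟩ := hp
  obtain ⟨z', h1', h2'⟩ := hq
  exact hlt.mul_right _ _ _ _ _ (hlt.mul_left _ _ _ _ _ h h1 h1') h2 h2'

theorem exists_max (hlt : IsAdmissibleOrder lt) {S : Set (QPath V)} (hS : S.Finite)
    (hne : S.Nonempty) : ∃ p ∈ S, ∀ q ∈ S, q = p ∨ lt q p := by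
  induction S, hS using Set.Finite.induction_on with
  | empty => exact absurd hne Set.not_nonempty_empty
  | @insert a S _ _ ih =>
    rcases S.eq_empty_or_nonempty with rfl | hne'
    · exact ⟨a, by simp, by simp⟩
    · obtain ⟨p, hp, hmax⟩ := ih hne'
      have key : ∀ b c : QPath V, b = c ∨ lt b c → ∀ q, q = b ∨ lt q b → q = c ∨ lt q c := by
        rintro b c (rfl | h) q (rfl | h')
        · exact Or.inl rfl
        · exact Or.inr h'
        · exact Or.inr h
        · exact Or.inr (hlt.trans h' h)
      rcases hlt.total a p with h | h | h
      · refine ⟨p, Or.inr hp, ?_⟩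
        rintro q (rfl | hq)
        · exact Or.inr h
        · exact hmax q hq
      · refine ⟨p, Or.inr hp, ?_⟩
        rintro q (rfl | hq)
        · exact Or.inl h
        · exact hmax q hq
      · refine ⟨a, Or.inl rfl, ?_⟩
        rintro q (rfl | hq)
        · exact Or.inl rfl
        · exact key p a (Or.inr h) q (hmax q hq)

end IsAdmissibleOrder

/-! ### Coefficients and two-sided ideals in the path algebra -/

namespace PathAlgebra

variable {R : Type w} [CommRing R] {V : Type u} [Quiver.{v} V]

theorem ext_coeff {x y : PathAlgebra R V} (h : ∀ p, coeff x p = coeff y p) : x = y := Finsupp.ext h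

theorem coeff_zero (p : QPath V) : coeff (0 : PathAlgebra R V) p = 0 := rfl

theorem coeff_add (x y : PathAlgebra R V) (p : QPath V) :
    coeff (x + y) p = coeff x p + coeff y p := rfl

theorem coeff_sub (x y : PathAlgebra R V) (p : QPath V) :
    coeff (x - y) p = coeff x p - coeff y p := rfl

theorem coeff_smul (a : R) (x : PathAlgebra R V) (p : QPath V) :
    coeff (a • x) p = a * coeff x p := rfl

/-- The coefficient of a path as a linear functional. -/
noncomputable def coeffHom (R : Type w) [CommRing R] (p : QPath V) : PathAlgebra R V →ₗ[R] R where
  toFun x := coeff x p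
  map_add' x y := coeff_add x y p
  map_smul' a x := coeff_smul a x p

theorem coeff_mono_self (p : QPath V) : coeff (mono R p) p = 1 := Finsupp.single_eq_same

theorem coeff_mono_of_ne {p q : QPath V} (h : q ≠ p) : coeff (mono R p) q = 0 :=
  Finsupp.single_eq_of_ne h

theorem eq_of_coeff_mono_ne_zero {p q : QPath V} (h : coeff (mono R p) q ≠ 0) : q = p :=
  by_contra fun hne => h (coeff_mono_of_ne hne)

theorem single_eq_smul (p : QPath V) (a : R) : single p a = a • mono R p := by
  refine Eq.trans ?_ (Finsupp.smul_single a p (1 : R)).symm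
  rw [smul_eq_mul, mul_one]
  rfl

theorem finite_coeff_ne_zero (x : PathAlgebra R V) : {p | coeff x p ≠ 0}.Finite :=
  Finsupp.hasFiniteSupport x

theorem mem_span_mono {S : Set (QPath V)} {x : PathAlgebra R V} :
    x ∈ Submodule.span R (mono R '' S) ↔ ∀ p, coeff x p ≠ 0 → p ∈ S := by
  have h : Finsupp.supported R R S = Submodule.span R (mono R '' S) :=
    Finsupp.supported_eq_span_single R S
  rw [← h]
  refine (Finsupp.mem_supported' R (M := R) (s := S) x).trans ⟨fun h p hp => ?_, fun h p hp => ?_⟩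
  · exact by_contra fun hn => hp (h p hn)
  · exact by_contra fun hn => hp (h p hn)

@[elab_as_elim]
theorem induction_mono {P : PathAlgebra R V → Prop} (x : PathAlgebra R V) (zero : P 0)
    (add : ∀ x y, P x → P y → P (x + y)) (smul : ∀ (a : R) p, P (a • mono R p)) : P x := by
  refine Finsupp.induction_linear (motive := P) x zero add fun p a => ?_
  have := smul a p
  rwa [← single_eq_smul] at this

instance : IsScalarTower R (PathAlgebra R V) (PathAlgebra R V) :=
  ⟨fun a x y => by
    change mulHom (a • x) y = a • mulHom x y
    rw [map_smul, LinearMap.smul_apply]⟩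

instance : SMulCommClass R (PathAlgebra R V) (PathAlgebra R V) :=
  ⟨fun a x y => (map_smul (mulHom x) a y).symm⟩

theorem mono_mul_of_isComp {p q z : QPath V} (h : IsComp p q z) :
    mono R p * mono R q = mono R z := by
  obtain ⟨h, rfl⟩ := h
  rw [mono_mul_mono, monoMul, dif_pos h]

theorem mono_mul_of_ne {p q : QPath V} (h : p.tgt ≠ q.src) : mono R p * mono R q = 0 := by
  rw [mono_mul_mono, monoMul, dif_neg h]

theorem mono_mul_mono_eq (p q : QPath V) :
    mono R p * mono R q = 0 ∨ ∃ z, IsComp p q z ∧ mono R p * mono R q = mono R z := by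
  by_cases h : p.tgt = q.src
  · exact Or.inr ⟨_, ⟨h, rfl⟩, mono_mul_of_isComp ⟨h, rfl⟩⟩
  · exact Or.inl (mono_mul_of_ne h)

theorem mono_mul_mul_of_isComp₃ {r q s p : QPath V} (h : IsComp₃ r q s p) :
    mono R r * mono R q * mono R s = mono R p := by
  obtain ⟨z, h1, h2⟩ := h
  rw [mono_mul_of_isComp h1, mono_mul_of_isComp h2]

theorem mono_mul_mul_eq (r q s : QPath V) :
    mono R r * mono R q * mono R s = 0 ∨
      ∃ p, IsComp₃ r q s p ∧ mono R r * mono R q * mono R s = mono R p := by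
  rcases mono_mul_mono_eq (R := R) r q with h | ⟨z, hz, h⟩
  · exact Or.inl (by rw [h, zero_mul])
  · rcases mono_mul_mono_eq (R := R) z s with h' | ⟨p, hp, h'⟩
    · exact Or.inl (by rw [h, h'])
    · exact Or.inr ⟨p, ⟨z, hz, hp⟩, by rw [h, h']⟩

/-- The linear map `x ↦ r x s` for paths `r`, `s`. -/
noncomputable def sandwich (R : Type w) [CommRing R] (r s : QPath V) :
    PathAlgebra R V →ₗ[R] PathAlgebra R V where
  toFun x := mono R r * x * mono R s
  map_add' x y := by rw [mul_add, add_mul]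
  map_smul' a x := by rw [mul_smul_comm, smul_mul_assoc, RingHom.id_apply]

/-- By cancellation, `q` is the only path that `r · s` sends to `p`, so no two terms of `x` can
merge there. -/
theorem coeff_sandwich {r q s p : QPath V} (h : IsComp₃ r q s p) (x : PathAlgebra R V) :
    coeff (mono R r * x * mono R s) p = coeff x q := by
  have key : (coeffHom R p).comp (sandwich R r s) = coeffHom R q := by
    refine hom_ext fun q' => ?_
    change coeff (mono R r * mono R q' * mono R s) p = coeff (mono R q') q
    by_cases hq : q' = q
    · subst hq
      rw [mono_mul_mul_of_isComp₃ h, coeff_mono_self, coeff_mono_self]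
    · rw [coeff_mono_of_ne (Ne.symm hq)]
      rcases mono_mul_mul_eq (R := R) r q' s with h' | ⟨p', hp', h'⟩
      · rw [h', coeff_zero]
      · rw [h']
        refine coeff_mono_of_ne ?_
        rintro rfl
        exact hq (hp'.cancel h)
  exact LinearMap.congr_fun key x

theorem exists_of_coeff_sandwich_ne_zero {r s p : QPath V} {x : PathAlgebra R V}
    (h : coeff (mono R r * x * mono R s) p ≠ 0) : ∃ q, IsComp₃ r q s p ∧ coeff x q ≠ 0 := by
  by_cases hq : ∃ q, IsComp₃ r q s p
  · obtain ⟨q, hq⟩ := hq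
    exact ⟨q, hq, by rwa [coeff_sandwich hq] at h⟩
  · have key : (coeffHom R p).comp (sandwich R r s) = 0 := by
      refine hom_ext fun q' => ?_
      change coeff (mono R r * mono R q' * mono R s) p = 0
      rcases mono_mul_mul_eq (R := R) r q' s with h' | ⟨p', hp', h'⟩
      · rw [h', coeff_zero]
      · rw [h']
        refine coeff_mono_of_ne ?_
        rintro rfl
        exact hq ⟨q', hp'⟩
    exact absurd (LinearMap.congr_fun key x) h

theorem mono_mul_sandwich (p r s : QPath V) (x : PathAlgebra R V) :
    mono R p * (mono R r * x * mono R s) = 0 ∨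
      ∃ r', IsComp p r r' ∧ mono R p * (mono R r * x * mono R s) = mono R r' * x * mono R s := by
  rcases mono_mul_mono_eq (R := R) p r with h | ⟨z, hz, h⟩
  · exact Or.inl (by rw [← mul_assoc, ← mul_assoc, h, zero_mul, zero_mul])
  · exact Or.inr ⟨z, hz, by rw [← mul_assoc, ← mul_assoc, h]⟩

theorem sandwich_mul_mono (p r s : QPath V) (x : PathAlgebra R V) :
    mono R r * x * mono R s * mono R p = 0 ∨
      ∃ s', IsComp s p s' ∧ mono R r * x * mono R s * mono R p = mono R r * x * mono R s' := by
  rcases mono_mul_mono_eq (R := R) s p with h | ⟨z, hz, h⟩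
  · exact Or.inl (by rw [mul_assoc, h, mul_zero])
  · exact Or.inr ⟨z, hz, by rw [mul_assoc, h]⟩

/-! ### Change of coefficient ring -/

section MapCoeff

variable {S : Type*} [CommRing S] (φ : R →+* S)

theorem coeff_mapCoeff (x : PathAlgebra R V) (p : QPath V) :
    coeff (mapCoeff φ x) p = φ (coeff x p) := rfl

theorem mapCoeff_zero : mapCoeff φ (0 : PathAlgebra R V) = 0 :=
  ext_coeff fun _ => map_zero φ

theorem mapCoeff_add (x y : PathAlgebra R V) :
    mapCoeff φ (x + y) = mapCoeff φ x + mapCoeff φ y :=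
  ext_coeff fun _ => map_add φ _ _

theorem mapCoeff_sub (x y : PathAlgebra R V) :
    mapCoeff φ (x - y) = mapCoeff φ x - mapCoeff φ y :=
  ext_coeff fun _ => map_sub φ _ _

theorem mapCoeff_smul (a : R) (x : PathAlgebra R V) :
    mapCoeff φ (a • x) = φ a • mapCoeff φ x :=
  ext_coeff fun _ => map_mul φ _ _

theorem mapCoeff_mono (p : QPath V) : mapCoeff φ (mono R p) = mono S p := by
  refine (Finsupp.mapRange_single (hf := map_zero φ)).trans ?_
  rw [map_one]
  rfl

theorem mapCoeff_single (p : QPath V) (a : R) : mapCoeff φ (single p a) = single p (φ a) :=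
  Finsupp.mapRange_single (hf := map_zero φ)

theorem mapCoeff_mul (x y : PathAlgebra R V) :
    mapCoeff φ (x * y) = mapCoeff φ x * mapCoeff φ y := by
  induction x using induction_mono with
  | zero => rw [zero_mul, mapCoeff_zero, zero_mul]
  | add x x' h h' => rw [add_mul, mapCoeff_add, mapCoeff_add, h, h', add_mul]
  | smul a p =>
    rw [smul_mul_assoc, mapCoeff_smul, mapCoeff_smul, smul_mul_assoc]
    congr 1
    induction y using induction_mono with
    | zero => rw [mul_zero, mapCoeff_zero, mul_zero]
    | add x x' h h' => rw [mul_add, mapCoeff_add, mapCoeff_add, h, h', mul_add]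
    | smul b q =>
      rw [mul_smul_comm, mapCoeff_smul, mapCoeff_smul, mul_smul_comm]
      congr 1
      rw [mapCoeff_mono, mapCoeff_mono]
      by_cases h : p.tgt = q.src
      · rw [mono_mul_of_isComp ⟨h, rfl⟩, mono_mul_of_isComp ⟨h, rfl⟩, mapCoeff_mono]
      · rw [mono_mul_of_ne h, mono_mul_of_ne h, mapCoeff_zero]

theorem mapCoeff_injective (hφ : Function.Injective φ) :
    Function.Injective (mapCoeff φ : PathAlgebra R V → PathAlgebra S V) :=
  fun x y h => ext_coeff fun p => hφ <| by
    rw [← coeff_mapCoeff, ← coeff_mapCoeff, h]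

end MapCoeff

/-- The two-sided ideal generated by a set `S` consists of the linear combinations of the elements
`r f s` with `f ∈ S` and paths `r`, `s`, provided that each `f ∈ S` is of this form. -/
theorem mem_span_iff_mem_span_sandwich {S : Set (PathAlgebra R V)}
    (hS : ∀ f ∈ S, ∃ r s, mono R r * f * mono R s = f) {x : PathAlgebra R V} :
    x ∈ TwoSidedIdeal.span S ↔
      x ∈ Submodule.span R {y | ∃ f ∈ S, ∃ r s, y = mono R r * f * mono R s} := by
  set J := Submodule.span R {y | ∃ f ∈ S, ∃ r s, y = mono R r * f * mono R s} with hJ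
  constructor
  · have hl : ∀ {x y : PathAlgebra R V}, y ∈ J → x * y ∈ J := by
      intro x y hy
      induction x using induction_mono with
      | zero => rw [zero_mul]; exact J.zero_mem
      | add x x' h h' => rw [add_mul]; exact J.add_mem h h'
      | smul a p =>
        rw [smul_mul_assoc]
        refine J.smul_mem a ?_
        induction hy using Submodule.span_induction with
        | mem y hy =>
          obtain ⟨f, hf, r, s, rfl⟩ := hy
          rcases mono_mul_sandwich p r s f with h | ⟨r', -, h⟩
          · rw [h]; exact J.zero_mem
          · rw [h]; exact Submodule.subset_span ⟨f, hf, r', s, rfl⟩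
        | zero => rw [mul_zero]; exact J.zero_mem
        | add y y' _ _ h h' => rw [mul_add]; exact J.add_mem h h'
        | smul b y _ h => rw [mul_smul_comm]; exact J.smul_mem b h
    have hr : ∀ {x y : PathAlgebra R V}, x ∈ J → x * y ∈ J := by
      intro y x hy
      induction x using induction_mono with
      | zero => rw [mul_zero]; exact J.zero_mem
      | add x x' h h' => rw [mul_add]; exact J.add_mem h h'
      | smul a p =>
        rw [mul_smul_comm]
        refine J.smul_mem a ?_
        induction hy using Submodule.span_induction with
        | mem y hy =>
          obtain ⟨f, hf, r, s, rfl⟩ := hy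
          rcases sandwich_mul_mono p r s f with h | ⟨s', -, h⟩
          · rw [h]; exact J.zero_mem
          · rw [h]; exact Submodule.subset_span ⟨f, hf, r, s', rfl⟩
        | zero => rw [zero_mul]; exact J.zero_mem
        | add y y' _ _ h h' => rw [add_mul]; exact J.add_mem h h'
        | smul b y _ h => rw [smul_mul_assoc]; exact J.smul_mem b h
    intro hx
    have hle : TwoSidedIdeal.span S ≤
        TwoSidedIdeal.mk' (J : Set (PathAlgebra R V)) J.zero_mem J.add_mem J.neg_mem hl hr := by
      rw [TwoSidedIdeal.span_le, TwoSidedIdeal.coe_mk']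
      intro f hf
      -- Without a unit, a generator need not be a combination of products `r f s`; here the
      -- hypothesis on `S` supplies this.
      obtain ⟨r, s, h⟩ := hS f hf
      exact Submodule.subset_span ⟨f, hf, r, s, h.symm⟩
    have := hle hx
    rwa [TwoSidedIdeal.mem_mk'] at this
  · intro hx
    induction hx using Submodule.closure_induction with
    | zero => exact TwoSidedIdeal.zero_mem _
    | add y y' _ _ h h' => exact TwoSidedIdeal.add_mem _ h h'
    | smul_mem a y hy =>
      obtain ⟨f, hf, r, s, rfl⟩ := hy
      -- The scalar moves into the left factor: a two-sided ideal of a non-unital ring is not closed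
      -- under scalars by definition.
      rw [← smul_mul_assoc, ← smul_mul_assoc]
      exact TwoSidedIdeal.mul_mem_right _ _ _ (TwoSidedIdeal.mul_mem_left _ _ _
        (TwoSidedIdeal.subset_span hf))

end PathAlgebra

theorem QPath.Parallel.symm {V : Type u} [Quiver.{v} V] {p q : QPath V} (h : Parallel p q) :
    Parallel q p := ⟨h.1.symm, h.2.symm⟩

theorem QPath.IsComp₃.extend {V : Type u} [Quiver.{v} V] {a b r t s p r' s' : QPath V}
    (h : IsComp₃ r t s p) (hr : IsComp a r r') (hs : IsComp s b s') :
    ∃ p', IsComp₃ r' t s' p' ∧ IsComp₃ a p b p' := by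
  obtain ⟨y, h1, h2⟩ := id h
  obtain ⟨x, hx⟩ := IsComp.exists_of_eq (p := a) (q := p)
    (by rw [hr.tgt_eq_src, h2.src_eq, h1.src_eq])
  obtain ⟨p', hp'⟩ := IsComp.exists_of_eq (p := x) (q := b)
    (by rw [hx.tgt_eq, h2.tgt_eq, hs.tgt_eq_src])
  obtain ⟨r'', s'', h3, h4, h5⟩ := IsComp₃.trans ⟨x, hx, hp'⟩ h
  obtain rfl := h3.unique hr
  obtain rfl := h4.unique hs
  exact ⟨p', h5, x, hx, hp'⟩

/-! ### The elements `g_t` and their tips -/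

section TailElement

variable {V : Type u} [Quiver.{v} V] {lt : QPath V → QPath V → Prop} {R : Type w} [CommRing R]
  {T : Set (QPath V)} (c : CoordIndex lt T → R)

theorem mono_sub_tailElement_mem (t : T) :
    mono R (t : QPath V) - tailElement lt T c t ∈
      Submodule.span R (mono R '' nontipsBelow lt T (t : QPath V)) := by
  rw [tailElement, sub_sub_cancel]
  refine finsum_induction (· ∈ Submodule.span R (mono R '' nontipsBelow lt T (t : QPath V)))
    (Submodule.zero_mem _) (fun _ _ => Submodule.add_mem _) fun n => ?_
  rw [single_eq_smul]
  exact Submodule.smul_mem _ _ (Submodule.subset_span ⟨n, n.2, rfl⟩)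

theorem coeff_tailElement_ne_zero {t : T} {q : QPath V} (h : coeff (tailElement lt T c t) q ≠ 0) :
    q = t ∨ q ∈ nontipsBelow lt T (t : QPath V) := by
  by_cases hq : q = t
  · exact Or.inl hq
  · refine Or.inr (mem_span_mono.1 (mono_sub_tailElement_mem c t) q ?_)
    rw [coeff_sub, coeff_mono_of_ne hq, zero_sub]
    exact neg_ne_zero.2 h

theorem parallel_of_coeff_tailElement_ne_zero {t : T} {q : QPath V}
    (h : coeff (tailElement lt T c t) q ≠ 0) : Parallel q t := by
  rcases coeff_tailElement_ne_zero c h with rfl | h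
  · exact ⟨rfl, rfl⟩
  · exact h.2.1

variable (hlt : IsAdmissibleOrder lt)
include hlt

theorem coeff_tailElement_self (t : T) : coeff (tailElement lt T c t) (t : QPath V) = 1 := by
  have h : coeff (mono R (t : QPath V) - tailElement lt T c t) (t : QPath V) = 0 :=
    by_contra fun h => hlt.irrefl _ (mem_span_mono.1 (mono_sub_tailElement_mem c t) _ h).2.2
  rw [coeff_sub, coeff_mono_self] at h
  exact (sub_eq_zero.1 h).symm

theorem isTip_tailElement [Nontrivial R] (t : T) : IsTip lt (tailElement lt T c t) t := by
  refine ⟨by rw [coeff_tailElement_self c hlt]; exact one_ne_zero, fun q hq => ?_⟩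
  exact (coeff_tailElement_ne_zero c hq).imp_right fun h => h.2.2

theorem IsAdmissibleOrder.isTip_unique {x : PathAlgebra R V} {p q : QPath V} (hp : IsTip lt x p)
    (hq : IsTip lt x q) : p = q := by
  rcases hp.2 q hq.1 with h | h
  · exact h.symm
  · rcases hq.2 p hp.1 with h' | h'
    · exact h'
    · exact absurd (hlt.trans h h') (hlt.irrefl _)

end TailElement

/-! ### Spans of products `r g_t s` with bounded leading path -/

section SandwichSpan

variable {V : Type u} [Quiver.{v} V] {lt : QPath V → QPath V → Prop} {R : Type w} [CommRing R]
  {T : Set (QPath V)} (c : CoordIndex lt T → R)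

/-- The linear combinations of the elements `r g s`, where `g` is the element with tip `t ∈ T` and
coordinates `c`, and `r t s` is a path with the property `P`. -/
noncomputable def sandwichSpan (P : QPath V → Prop) : Submodule R (PathAlgebra R V) :=
  Submodule.span R {y | ∃ (t : T) (r s p : QPath V), IsComp₃ r t s p ∧ P p ∧
    y = mono R r * tailElement lt T c t * mono R s}

variable {c}

theorem sandwich_mem_sandwichSpan {P : QPath V → Prop} {t : T} {r s p : QPath V}
    (h : IsComp₃ r t s p) (hp : P p) :
    mono R r * tailElement lt T c t * mono R s ∈ sandwichSpan c P :=
  Submodule.subset_span ⟨t, r, s, p, h, hp, rfl⟩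

theorem sandwichSpan_mono {P Q : QPath V → Prop} (h : ∀ p, P p → Q p) :
    sandwichSpan c P ≤ sandwichSpan c Q := by
  refine Submodule.span_mono ?_
  rintro _ ⟨t, r, s, p, h1, h2, rfl⟩
  exact ⟨t, r, s, p, h1, h p h2, rfl⟩

/-- All terms of `g_t` are parallel to `t`. Hence `r g_t s` is zero unless `r t s` is a path, and
`g_t` is itself such a product, with the two end vertices of `t` as outer factors. -/
theorem mem_span_range_tailElement_iff {x : PathAlgebra R V} :
    x ∈ TwoSidedIdeal.span (Set.range (tailElement lt T c)) ↔
      x ∈ sandwichSpan c fun _ => True := by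
  rw [mem_span_iff_mem_span_sandwich]
  · have key : ∀ A B : Submodule R (PathAlgebra R V), A ≤ B → B ≤ A → (x ∈ A ↔ x ∈ B) :=
      fun A B h h' => ⟨fun hx => h hx, fun hx => h' hx⟩
    refine key _ _ (Submodule.span_le.2 ?_) (Submodule.span_le.2 ?_)
    · rintro _ ⟨_, ⟨t, rfl⟩, r, s, rfl⟩
      by_cases h : ∃ p, coeff (mono R r * tailElement lt T c t * mono R s) p ≠ 0
      · obtain ⟨p, hp⟩ := h
        obtain ⟨q, hq, hq'⟩ := exists_of_coeff_sandwich_ne_zero hp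
        obtain ⟨w, hw⟩ := hq.of_parallel (parallel_of_coeff_tailElement_ne_zero c hq').symm
        exact sandwich_mem_sandwichSpan hw trivial
      · have h0 : mono R r * tailElement lt T c t * mono R s = 0 :=
          ext_coeff fun p => by_contra fun hp => h ⟨p, hp⟩
        rw [h0]
        exact Submodule.zero_mem _
    · rintro _ ⟨t, r, s, p, -, -, rfl⟩
      exact Submodule.subset_span ⟨_, ⟨t, rfl⟩, r, s, rfl⟩
  · rintro _ ⟨t, rfl⟩
    refine ⟨vertex (t : QPath V).src, vertex (t : QPath V).tgt, ?_⟩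
    have key : ∀ q : QPath V, Parallel q t →
        IsComp₃ (vertex (t : QPath V).src) q (vertex (t : QPath V).tgt) q := by
      intro q hq
      rw [← hq.1, ← hq.2]
      exact isComp₃_vertex q
    refine ext_coeff fun p => ?_
    by_cases hp : Parallel p t
    · exact coeff_sandwich (key p hp) _
    · have h1 : coeff (tailElement lt T c t) p = 0 :=
        by_contra fun h => hp (parallel_of_coeff_tailElement_ne_zero c h)
      rw [h1]
      by_contra h
      obtain ⟨q, hq, hq'⟩ := exists_of_coeff_sandwich_ne_zero h
      have hq1 := parallel_of_coeff_tailElement_ne_zero c hq'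
      obtain rfl := hq.unique (key q hq1)
      exact hp hq1

variable (hlt : IsAdmissibleOrder lt)
include hlt

theorem sandwich_mem_of_mem {z w a b : QPath V} {x : PathAlgebra R V}
    (hx : x ∈ sandwichSpan c (lt · z)) (h : IsComp₃ a z b w) :
    mono R a * x * mono R b ∈ sandwichSpan c (lt · w) := by
  induction hx using Submodule.span_induction with
  | mem x hx =>
    obtain ⟨t, r, s, p, h1, h2, rfl⟩ := hx
    rcases mono_mul_sandwich a r s (tailElement lt T c t) with h0 | ⟨r', hr, h0⟩
    · rw [h0, zero_mul]
      exact Submodule.zero_mem _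
    · rw [h0]
      rcases sandwich_mul_mono b r' s (tailElement lt T c t) with h0' | ⟨s', hs, h0'⟩
      · rw [h0']
        exact Submodule.zero_mem _
      · rw [h0']
        obtain ⟨p', h3, h4⟩ := h1.extend hr hs
        exact sandwich_mem_sandwichSpan h3 (hlt.isComp₃ h2 h h4)
  | zero => rw [mul_zero, zero_mul]; exact Submodule.zero_mem _
  | add x y _ _ h h' => rw [mul_add, add_mul]; exact Submodule.add_mem _ h h'
  | smul k x _ h => rw [mul_smul_comm, smul_mul_assoc]; exact Submodule.smul_mem _ k h

theorem exists_of_mem_sandwichSpan {P : QPath V → Prop} {x : PathAlgebra R V}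
    (hx : x ∈ sandwichSpan c P) {p : QPath V} (hp : coeff x p ≠ 0) :
    ∃ q, P q ∧ (p = q ∨ lt p q) := by
  induction hx using Submodule.span_induction with
  | mem x hx =>
    obtain ⟨t, r, s, z, h1, h2, rfl⟩ := hx
    refine ⟨z, h2, ?_⟩
    obtain ⟨q, hq, hq'⟩ := exists_of_coeff_sandwich_ne_zero hp
    rcases coeff_tailElement_ne_zero c hq' with rfl | h
    · exact Or.inl (hq.unique h1)
    · exact Or.inr (hlt.isComp₃ h.2.2 h1 hq)
  | zero => exact absurd rfl hp
  | add x y _ _ h h' =>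
    by_cases hx : coeff x p = 0
    · refine h' fun hy => hp ?_
      rw [coeff_add, hx, hy, add_zero]
    · exact h hx
  | smul k x _ h =>
    refine h fun hx => hp ?_
    rw [coeff_smul, hx, mul_zero]

theorem lt_of_mem_sandwichSpan {z : QPath V} {x : PathAlgebra R V}
    (hx : x ∈ sandwichSpan c (lt · z)) {p : QPath V} (hp : coeff x p ≠ 0) : lt p z := by
  obtain ⟨q, hq, rfl | h⟩ := exists_of_mem_sandwichSpan hlt hx hp
  · exact hq
  · exact hlt.trans h hq

/-- A combination uses finitely many products, and the largest of their leading paths is a bound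
that itself satisfies `P`. This turns a strict bound into a smaller weak one, as the induction in
`eq_zero_of_mem_sandwichSpan_le` requires. -/
theorem exists_bound_of_mem_sandwichSpan {P : QPath V → Prop} {x : PathAlgebra R V}
    (hx : x ∈ sandwichSpan c P) :
    x = 0 ∨ ∃ z, P z ∧ x ∈ sandwichSpan c fun p => p = z ∨ lt p z := by
  have key : ∀ {z z' : QPath V}, lt z z' →
      (sandwichSpan c fun p => p = z ∨ lt p z) ≤ sandwichSpan c fun p => p = z' ∨ lt p z' := by
    refine fun {z z'} h => sandwichSpan_mono ?_
    rintro p (rfl | hp)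
    · exact Or.inr h
    · exact Or.inr (hlt.trans hp h)
  induction hx using Submodule.span_induction with
  | mem x hx =>
    obtain ⟨t, r, s, z, h1, h2, rfl⟩ := hx
    exact Or.inr ⟨z, h2, sandwich_mem_sandwichSpan h1 (Or.inl rfl)⟩
  | zero => exact Or.inl rfl
  | add x y _ _ h h' =>
    rcases h with rfl | ⟨z, hz, h⟩
    · rwa [zero_add]
    · rcases h' with rfl | ⟨z', hz', h'⟩
      · rw [add_zero]
        exact Or.inr ⟨z, hz, h⟩
      · right
        rcases hlt.total z z' with hzz | rfl | hzz
        · exact ⟨z', hz', Submodule.add_mem _ (key hzz h) h'⟩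
        · exact ⟨z, hz, Submodule.add_mem _ h h'⟩
        · exact ⟨z, hz, Submodule.add_mem _ h (key hzz h')⟩
  | smul k x _ h =>
    rcases h with rfl | ⟨z, hz, h⟩
    · exact Or.inl (smul_zero k)
    · exact Or.inr ⟨z, hz, Submodule.smul_mem _ k h⟩

/-- Every path in the tail of `g_{t'}` is smaller than `t'`, so substituting it inside `s` lowers
the leading path. Together with its left counterpart this settles disjoint occurrences. -/
theorem sandwich_tail_right_mem {t t' : T} {r s z f b : QPath V} (h : IsComp₃ r t s z)
    (h' : IsComp₃ f t' b s) :
    mono R r * tailElement lt T c t *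
      (mono R f * (mono R (t' : QPath V) - tailElement lt T c t') * mono R b) ∈
        sandwichSpan c (lt · z) := by
  have hy := mono_sub_tailElement_mem c t'
  set y := mono R (t' : QPath V) - tailElement lt T c t'
  clear_value y
  induction hy using Submodule.span_induction with
  | mem y hy =>
    obtain ⟨n, hn, rfl⟩ := hy
    obtain ⟨s', hs'⟩ := h'.of_parallel hn.2.1
    have hlt' := hlt.isComp₃ hn.2.2 h' hs'
    rw [mono_mul_mul_of_isComp₃ hs']
    obtain ⟨y, h1, h2⟩ := h
    obtain ⟨w, hw⟩ := IsComp.exists_of_eq (p := y) (q := s')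
      (by rw [(h'.parallel hs').1, h2.tgt_eq_src])
    exact sandwich_mem_sandwichSpan ⟨y, h1, hw⟩ (hlt.mul_left _ _ _ _ _ hlt' h2 hw)
  | zero => rw [mul_zero, zero_mul, mul_zero]; exact Submodule.zero_mem _
  | add x y _ _ h h' => rw [mul_add, add_mul, mul_add]; exact Submodule.add_mem _ h h'
  | smul k x _ h =>
    rw [mul_smul_comm, smul_mul_assoc, mul_smul_comm]
    exact Submodule.smul_mem _ k h

theorem sandwich_tail_left_mem {t t' : T} {r s z f a : QPath V} (h : IsComp₃ r t' s z)
    (h' : IsComp₃ a t f r) :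
    mono R a * (mono R (t : QPath V) - tailElement lt T c t) * mono R f *
      tailElement lt T c t' * mono R s ∈ sandwichSpan c (lt · z) := by
  have hy := mono_sub_tailElement_mem c t
  set y := mono R (t : QPath V) - tailElement lt T c t
  clear_value y
  induction hy using Submodule.span_induction with
  | mem y hy =>
    obtain ⟨n, hn, rfl⟩ := hy
    obtain ⟨r', hr'⟩ := h'.of_parallel hn.2.1
    have hlt' := hlt.isComp₃ hn.2.2 h' hr'
    rw [mono_mul_mul_of_isComp₃ hr']
    obtain ⟨y, h1, h2⟩ := h.right_assoc
    obtain ⟨w, hw⟩ := IsComp.exists_of_eq (p := r') (q := y)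
      (by rw [(h'.parallel hr').2, h2.tgt_eq_src])
    exact sandwich_mem_sandwichSpan (IsComp₃.of_right_assoc h1 hw)
      (hlt.mul_right _ _ _ _ _ hlt' h2 hw)
  | zero =>
    rw [mul_zero, zero_mul, zero_mul, zero_mul]
    exact Submodule.zero_mem _
  | add x y _ _ h h' =>
    rw [mul_add, add_mul, add_mul, add_mul]
    exact Submodule.add_mem _ h h'
  | smul k x _ h =>
    rw [mul_smul_comm, smul_mul_assoc, smul_mul_assoc, smul_mul_assoc]
    exact Submodule.smul_mem _ k h

end SandwichSpan

/-! ### The diamond lemma -/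

section Diamond

variable {V : Type u} [Quiver.{v} V] {lt : QPath V → QPath V → Prop} {R : Type w} [CommRing R]
  {T : Set (QPath V)}

/-- Every overlap of elements with coordinates `c` is a combination of elements `r g s` with
smaller leading paths than the overlap. -/
def OverlapsResolvable (c : CoordIndex lt T → R) : Prop :=
  ∀ (t t' : T) (m n z : QPath V), IsComp t m z → IsComp n t' z → 1 ≤ n.length → 1 ≤ m.length →
    m.length < (t' : QPath V).length →
    tailElement lt T c t * mono R m - mono R n * tailElement lt T c t' ∈ sandwichSpan c (lt · z)

variable {c : CoordIndex lt T → R} (hlt : IsAdmissibleOrder lt) (hred : IsTipReduced T)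
  (hov : OverlapsResolvable c)
include hlt hred hov

/-- Two occurrences of tips in `z` are disjoint, nested or properly overlapping. Disjoint ones
commute up to tails, nested ones coincide since `T` is tip-reduced, and the rest reduce to the
hypothesis on overlaps. -/
theorem sandwich_sub_sandwich_mem_of_le {t t' : T} {r s r' s' z : QPath V} (h : IsComp₃ r t s z)
    (h' : IsComp₃ r' t' s' z) (hle : r.length ≤ r'.length) :
    mono R r * tailElement lt T c t * mono R s - mono R r' * tailElement lt T c t' * mono R s' ∈
      sandwichSpan c (lt · z) := by
  obtain ⟨x, hx, hx'⟩ := h.right_assoc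
  obtain ⟨y, hy, hy'⟩ := h'.right_assoc
  obtain ⟨e, he, he'⟩ := hx'.exists_refinement hy' hle
  rcases le_or_gt (t : QPath V).length e.length with hl | hl
  · obtain ⟨f, hf, hf'⟩ := hx.exists_refinement he' hl
    have hr' : IsComp₃ r t f r' := IsComp₃.of_right_assoc hf he
    have hs : IsComp₃ f t' s' s := IsComp₃.of_right_assoc hy hf'
    have h1 := sandwich_tail_right_mem (R := R) (c := c) hlt h hs
    have h2 := sandwich_tail_left_mem (R := R) (c := c) hlt h' hr'
    have h3 := Submodule.sub_mem _ h1 h2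
    rw [← mono_mul_mul_of_isComp₃ hs, ← mono_mul_mul_of_isComp₃ hr']
    convert h3 using 1
    simp only [mul_sub, sub_mul, mul_assoc]
    abel
  · obtain ⟨t₁, ht₁, ht₁'⟩ := he'.exists_refinement hx hl.le
    have hlen := ht₁.length_eq
    rcases le_or_gt (t' : QPath V).length t₁.length with hl' | hl'
    · obtain ⟨b, hb, hb'⟩ := hy.exists_refinement ht₁' hl'
      have hsub : IsSubpath (t' : QPath V) t := hb.isSubpath_left.trans ht₁.isSubpath_right
      have htt : t' = t := by
        by_contra hne
        exact hred _ t'.2 _ t.2 (fun h => hne (Subtype.ext h)) hsub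
      subst htt
      have hlen' := hb.length_eq
      obtain rfl := he.eq_of_length_right (by omega)
      obtain rfl := hb'.eq_of_length_left (by omega)
      rw [sub_self]
      exact Submodule.zero_mem _
    -- Proper overlap: `t = e t₁` and `t' = t₁ m`, so `t m = e t'`. The common part `t₁` is
    -- nonempty, whence `m` is shorter than `t'`.
    · obtain ⟨m, hm, hm'⟩ := ht₁'.exists_refinement hy hl'.le
      have hlen' := hm.length_eq
      obtain ⟨u, hu, hu'⟩ := hm'.assoc' hx
      obtain ⟨y', hy₁, hy₂⟩ := ht₁.assoc hu
      obtain rfl := hy₁.unique hm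
      have he1 : 1 ≤ e.length := by
        by_contra h0
        obtain rfl := ht₁.eq_of_length_left (by omega)
        have hne : (t : QPath V) ≠ t' := fun h1 => hl'.ne (by rw [h1])
        exact hred _ t.2 _ t'.2 hne hm.isSubpath_left
      have key := hov t t' m e u hu hy₂ he1 (by omega) (by omega)
      have h1 := sandwich_mem_of_mem hlt key (IsComp₃.of_right_assoc hu' hx')
      rw [← mono_mul_of_isComp hm', ← mono_mul_of_isComp he]
      convert h1 using 1
      simp only [mul_sub, sub_mul, mul_assoc]

theorem sandwich_sub_sandwich_mem {t t' : T} {r s r' s' z : QPath V} (h : IsComp₃ r t s z)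
    (h' : IsComp₃ r' t' s' z) :
    mono R r * tailElement lt T c t * mono R s - mono R r' * tailElement lt T c t' * mono R s' ∈
      sandwichSpan c (lt · z) := by
  rcases le_total r.length r'.length with hle | hle
  · exact sandwich_sub_sandwich_mem_of_le hlt hred hov h h' hle
  · rw [← neg_sub]
    exact Submodule.neg_mem _ (sandwich_sub_sandwich_mem_of_le hlt hred hov h' h hle)

theorem eq_zero_of_mem_sandwichSpan_le (z : QPath V) {x : PathAlgebra R V}
    (hx : x ∈ sandwichSpan c fun p => p = z ∨ lt p z)
    (hN : ∀ p, coeff x p ≠ 0 → p ∈ nontips T) : x = 0 := by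
  induction z using hlt.wf.induction with
  | _ z ih =>
    -- It is enough to eliminate the products with leading path exactly `z`.
    suffices hx' : x ∈ sandwichSpan c (lt · z) by
      rcases exists_bound_of_mem_sandwichSpan hlt hx' with h | ⟨z', hz', h⟩
      · exact h
      · exact ih z' hz' h
    by_cases hz : ∃ (t : T) (r s : QPath V), IsComp₃ r t s z
    · obtain ⟨t, r, s, h⟩ := hz
      -- All products with leading path `z` agree modulo smaller ones, so one representative
      -- suffices. Its multiplicity in `x` is the coefficient of `z`, which vanishes because `z ∉
      -- 𝒩`.
      have hle : (sandwichSpan c fun p => p = z ∨ lt p z) ≤ sandwichSpan c (lt · z) ⊔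
          Submodule.span R {mono R r * tailElement lt T c t * mono R s} := by
        refine Submodule.span_le.2 ?_
        rintro _ ⟨t', r', s', p, h', rfl | hp, rfl⟩
        · rw [← sub_add_cancel (mono R r' * tailElement lt T c t' * mono R s')
            (mono R r * tailElement lt T c t * mono R s)]
          exact Submodule.add_mem_sup (sandwich_sub_sandwich_mem hlt hred hov h' h)
            (Submodule.mem_span_singleton_self _)
        · exact Submodule.mem_sup_left (sandwich_mem_sandwichSpan h' hp)
      obtain ⟨y, hy, w, hw, rfl⟩ := Submodule.mem_sup.1 (hle hx)
      obtain ⟨a, rfl⟩ := Submodule.mem_span_singleton.1 hw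
      have hy0 : coeff y z = 0 :=
        by_contra fun h0 => hlt.irrefl z (lt_of_mem_sandwichSpan hlt hy h0)
      have ha : a = 0 := by
        by_contra ha
        refine hN z ?_ t t.2 ⟨r, s, h⟩
        rwa [coeff_add, coeff_smul, coeff_sandwich h, coeff_tailElement_self c hlt, hy0, zero_add,
          mul_one]
      rwa [ha, zero_smul, add_zero]
    · refine Submodule.span_mono ?_ hx
      rintro _ ⟨t, r, s, p, h, rfl | hp, rfl⟩
      · exact absurd ⟨t, r, s, h⟩ hz
      · exact ⟨t, r, s, p, h, hp, rfl⟩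

/-- If all overlaps are resolvable, the ideal generated by the elements with coordinates `c` has no
nonzero element supported outside the ideal generated by `T`. -/
theorem eq_zero_of_mem_span_of_overlapsResolvable {x : PathAlgebra R V}
    (hx : x ∈ TwoSidedIdeal.span (Set.range (tailElement lt T c)))
    (hN : ∀ p, coeff x p ≠ 0 → p ∈ nontips T) : x = 0 := by
  rcases exists_bound_of_mem_sandwichSpan hlt (mem_span_range_tailElement_iff.1 hx) with
    h | ⟨z, -, h⟩
  · exact h
  · exact eq_zero_of_mem_sandwichSpan_le hlt hred hov z h hN

end Diamond

/-! ### The variety in terms of ideal elements supported on `𝒩` -/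

section Variety

variable {V : Type u} [Quiver.{v} V] {lt : QPath V → QPath V → Prop}

theorem mono_mem_monomialIdeal_iff {R : Type w} [CommRing R] [Nontrivial R] {S : Set (QPath V)}
    {p : QPath V} : mono R p ∈ monomialIdeal R S ↔ ∃ s ∈ S, IsSubpath s p := by
  constructor
  · intro h
    rw [monomialIdeal, mem_span_iff_mem_span_sandwich] at h
    · have key : ∀ x ∈ Submodule.span R {y | ∃ f ∈ mono R '' S, ∃ r s,
          y = mono R r * f * mono R s}, coeff x p ≠ 0 → ∃ s ∈ S, IsSubpath s p := by
        intro x hx hp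
        induction hx using Submodule.span_induction with
        | mem x hx =>
          obtain ⟨_, ⟨t, ht, rfl⟩, r, s, rfl⟩ := hx
          obtain ⟨q, hq, hq'⟩ := exists_of_coeff_sandwich_ne_zero hp
          obtain rfl := eq_of_coeff_mono_ne_zero hq'
          exact ⟨q, ht, r, s, hq⟩
        | zero => exact absurd rfl hp
        | add x y _ _ h h' =>
          by_cases hx : coeff x p = 0
          · refine h' fun hy => hp ?_
            rw [coeff_add, hx, hy, add_zero]
          · exact h hx
        | smul k x _ h =>
          refine h fun hx => hp ?_
          rw [coeff_smul, hx, mul_zero]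
      exact key _ h (by rw [coeff_mono_self]; exact one_ne_zero)
    · rintro _ ⟨t, -, rfl⟩
      exact ⟨_, _, mono_mul_mul_of_isComp₃ (isComp₃_vertex t)⟩
  · rintro ⟨t, ht, r, s, h⟩
    rw [← mono_mul_mul_of_isComp₃ h]
    exact TwoSidedIdeal.mul_mem_right _ _ _ (TwoSidedIdeal.mul_mem_left _ _ _
      (TwoSidedIdeal.subset_span ⟨t, ht, rfl⟩))

theorem monomialIdeal_le_iff {R : Type w} [CommRing R] [Nontrivial R] {S S' : Set (QPath V)} :
    monomialIdeal R S ≤ monomialIdeal R S' ↔ ∀ p ∈ S, ∃ s ∈ S', IsSubpath s p := by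
  constructor
  · intro h p hp
    exact mono_mem_monomialIdeal_iff.1 (h (mono_mem_monomialIdeal_iff.2 ⟨p, hp, .refl p⟩))
  · intro h
    refine TwoSidedIdeal.span_le.2 ?_
    rintro _ ⟨p, hp, rfl⟩
    exact mono_mem_monomialIdeal_iff.2 (h p hp)

theorem IsAdmissibleOrder.exists_isTip (hlt : IsAdmissibleOrder lt) {R : Type w} [CommRing R]
    {x : PathAlgebra R V} (hx : x ≠ 0) : ∃ p, IsTip lt x p := by
  obtain ⟨p, hp, hmax⟩ := hlt.exists_max (finite_coeff_ne_zero x) (by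
    by_contra h
    exact hx (ext_coeff fun p => by_contra fun hp => h ⟨p, hp⟩))
  exact ⟨p, hp, hmax⟩

variable {K : Type w} [Field K]

theorem exists_sub_mem_of_mem_span {I : TwoSidedIdeal (PathAlgebra K V)}
    (hI : ∀ (a : K) x, x ∈ I → a • x ∈ I) {N₀ : Submodule K (PathAlgebra K V)} {B : Set (QPath V)}
    (hB : ∀ q ∈ B, ∃ N ∈ N₀, mono K q - N ∈ I) {y : PathAlgebra K V}
    (hy : y ∈ Submodule.span K (mono K '' B)) : ∃ N ∈ N₀, y - N ∈ I := by
  induction hy using Submodule.span_induction with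
  | mem y hy =>
    obtain ⟨q, hq, rfl⟩ := hy
    exact hB q hq
  | zero => exact ⟨0, Submodule.zero_mem _, by rw [sub_zero]; exact TwoSidedIdeal.zero_mem _⟩
  | add y z _ _ h h' =>
    obtain ⟨N, hN, h⟩ := h
    obtain ⟨N', hN', h'⟩ := h'
    exact ⟨N + N', Submodule.add_mem _ hN hN', by
      rw [add_sub_add_comm]; exact TwoSidedIdeal.add_mem _ h h'⟩
  | smul a y _ h =>
    obtain ⟨N, hN, h⟩ := h
    exact ⟨a • N, Submodule.smul_mem _ a hN, by rw [← smul_sub]; exact hI a _ h⟩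

/-- If all paths outside `A` are tips of an ideal, then every path is congruent, modulo the ideal,
to a combination of paths in `A` that are not larger. -/
theorem IsAdmissibleOrder.exists_sub_mem (hlt : IsAdmissibleOrder lt)
    {I : TwoSidedIdeal (PathAlgebra K V)} (hI : ∀ (a : K) x, x ∈ I → a • x ∈ I)
    {A : Set (QPath V)} (hA : ∀ p ∉ A, p ∈ tips lt (I : Set (PathAlgebra K V))) (p : QPath V) :
    ∃ N ∈ Submodule.span K (mono K '' (A ∩ {q | q = p ∨ lt q p})), mono K p - N ∈ I := by
  induction p using hlt.wf.induction with
  | _ p ih =>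
    by_cases hp : p ∈ A
    · exact ⟨mono K p, Submodule.subset_span ⟨p, ⟨hp, Or.inl rfl⟩, rfl⟩, by
        rw [sub_self]; exact TwoSidedIdeal.zero_mem _⟩
    · obtain ⟨x, hx, hx'⟩ := hA p hp
      have hxI : x ∈ I := hx
      have hB : ∀ q ∈ {q | lt q p}, ∃ N ∈ Submodule.span K
          (mono K '' (A ∩ {q | q = p ∨ lt q p})), mono K q - N ∈ I := by
        intro q hq
        obtain ⟨N, hN, h⟩ := ih q hq
        refine ⟨N, Submodule.span_mono (Set.image_mono ?_) hN, h⟩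
        rintro q' ⟨h1, rfl | h2⟩
        · exact ⟨h1, Or.inr hq⟩
        · exact ⟨h1, Or.inr (hlt.trans h2 hq)⟩
      -- Since `p` is the tip of `x ∈ I`, normalizing `x` and subtracting it from `p` leaves only
      -- smaller paths, to which the induction hypothesis applies.
      obtain ⟨N, hN, h⟩ := exists_sub_mem_of_mem_span hI hB (y := mono K p - (coeff x p)⁻¹ • x)
        (mem_span_mono.2 fun q hq => by
          by_cases hqp : q = p
          · subst hqp
            refine absurd ?_ hq
            rw [coeff_sub, coeff_mono_self, coeff_smul, inv_mul_cancel₀ hx'.1, sub_self]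
          · rw [coeff_sub, coeff_mono_of_ne hqp, zero_sub, coeff_smul] at hq
            exact (hx'.2 q (right_ne_zero_of_mul (neg_ne_zero.1 hq))).resolve_left hqp)
      refine ⟨N, hN, ?_⟩
      have h2 := TwoSidedIdeal.add_mem _ h (hI (coeff x p)⁻¹ x hxI)
      convert h2 using 1
      abel

theorem not_mem_nontips_iff {T : Set (QPath V)} {p : QPath V} :
    p ∉ nontips T ↔ ∃ t ∈ T, IsSubpath t p := by
  simp [nontips]

/-- The coordinates `c` belong to the variety if and only if the ideal generated by the
corresponding elements has no nonzero element supported on the paths without subpath in `T`. -/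
theorem mem_varietyOf_iff (hlt : IsAdmissibleOrder lt) {T : Set (QPath V)} (hred : IsTipReduced T)
    (c : CoordIndex lt T → K) :
    c ∈ varietyOf lt K T ↔ ∀ x ∈ TwoSidedIdeal.span (Set.range (tailElement lt T c)),
      (∀ p, coeff x p ≠ 0 → p ∈ nontips T) → x = 0 := by
  set I := TwoSidedIdeal.span (Set.range (tailElement lt T c)) with hI
  have hsmul : ∀ (a : K) x, x ∈ I → a • x ∈ I := fun a x hx =>
    mem_span_range_tailElement_iff.2
      (Submodule.smul_mem _ a (mem_span_range_tailElement_iff.1 hx))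
  have hgen : ∀ t : T, tailElement lt T c t ∈ I := fun t => TwoSidedIdeal.subset_span ⟨t, rfl⟩
  constructor
  · rintro ⟨T', hT', hG⟩ x hx hxN
    by_contra hx0
    obtain ⟨p, hp⟩ := hlt.exists_isTip hx0
    -- For `t ∈ T'`, the normal form of `t` gives a member `t - N` of the reduced basis, so it is
    -- some `g_{t₁}`. Its coefficient at the tip `t₁` is 1 and `N` contains no tips, which forces `t
    -- = t₁`.
    have hsub : T' ⊆ T := by
      intro t ht
      have ht' : t ∈ tips lt (I : Set (PathAlgebra K V)) := hT'.2 rfl ht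
      obtain ⟨N, hN', hmem⟩ := hlt.exists_sub_mem hsmul
        (A := (tips lt (I : Set (PathAlgebra K V)))ᶜ) (fun p hp => not_not.1 hp) t
      have hN := Submodule.span_mono (Set.image_mono Set.inter_subset_left) hN'
      have hg : mono K t - N ∈ Set.range (tailElement lt T c) := by
        rw [hG]
        exact ⟨hmem, t, ht, N, hN, (sub_add_cancel _ _).symm⟩
      obtain ⟨t₁, ht₁⟩ := hg
      have h1 : (t₁ : QPath V) ∈ tips lt (I : Set (PathAlgebra K V)) :=
        ⟨_, hgen t₁, isTip_tailElement c hlt t₁⟩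
      have h2 : coeff N (t₁ : QPath V) = 0 := by_contra fun h => mem_span_mono.1 hN _ h h1
      have h3 := coeff_tailElement_self c hlt t₁
      rw [ht₁, coeff_sub, h2, sub_zero] at h3
      obtain rfl := eq_of_coeff_mono_ne_zero (h3.trans_ne one_ne_zero)
      exact t₁.2
    obtain ⟨t, ht, htp⟩ := monomialIdeal_le_iff.1 hT'.1.ge p ⟨x, hx, hp⟩
    exact hxN p hp.1 t (hsub ht) htp
  · intro h
    have hTtips : ∀ p, p ∉ nontips T → p ∈ tips lt (I : Set (PathAlgebra K V)) := by
      intro p hp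
      obtain ⟨t, ht, r, s, hp⟩ := not_mem_nontips_iff.1 hp
      refine ⟨mono K r * tailElement lt T c ⟨t, ht⟩ * mono K s, TwoSidedIdeal.mul_mem_right _ _ _
        (TwoSidedIdeal.mul_mem_left _ _ _ (hgen _)), ?_, fun q hq => ?_⟩
      · rw [coeff_sandwich hp, coeff_tailElement_self c hlt ⟨t, ht⟩]
        exact one_ne_zero
      · obtain ⟨q', h1, h2⟩ := exists_of_coeff_sandwich_ne_zero hq
        rcases coeff_tailElement_ne_zero c h2 with rfl | h2
        · exact Or.inl (h1.unique hp)
        · exact Or.inr (hlt.isComp₃ h2.2.2 hp h1)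
    -- If a tip `p` were in `𝒩`, replacing the smaller terms of `x` by normal forms below `p` would
    -- give an ideal element supported on `𝒩` with nonzero coefficient at `p`.
    have htipsT : ∀ p ∈ tips lt (I : Set (PathAlgebra K V)), p ∉ nontips T := by
      rintro p ⟨x, hx, hxp⟩ hpN
      have hxI : x ∈ I := hx
      have hB : ∀ q ∈ {q | lt q p}, ∃ N ∈ Submodule.span K (mono K '' (nontips T ∩ {q | lt q p})),
          mono K q - N ∈ I := by
        intro q hq
        obtain ⟨N, hN, h⟩ := hlt.exists_sub_mem hsmul hTtips q
        refine ⟨N, Submodule.span_mono (Set.image_mono ?_) hN, h⟩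
        rintro q' ⟨h1, rfl | h2⟩
        · exact ⟨h1, hq⟩
        · exact ⟨h1, hlt.trans h2 hq⟩
      obtain ⟨N, hN, hmem⟩ := exists_sub_mem_of_mem_span hsmul hB
        (y := x - coeff x p • mono K p) (mem_span_mono.2 fun q hq => by
          by_cases hqp : q = p
          · subst hqp
            refine absurd ?_ hq
            rw [coeff_sub, coeff_smul, coeff_mono_self, mul_one, sub_self]
          · rw [coeff_sub, coeff_smul, coeff_mono_of_ne hqp, mul_zero, sub_zero] at hq
            exact (hxp.2 q hq).resolve_left hqp)
      have hNp : coeff N p = 0 := by_contra fun h => hlt.irrefl p (mem_span_mono.1 hN p h).2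
      have h0 := h (coeff x p • mono K p + N) (by
        have h2 := TwoSidedIdeal.sub_mem _ hxI hmem
        convert h2 using 1
        abel) (mem_span_mono.1 (Submodule.add_mem _
          (Submodule.smul_mem _ _ (Submodule.subset_span ⟨p, hpN, rfl⟩))
          (Submodule.span_mono (Set.image_mono Set.inter_subset_left) hN)))
      have h1 := congrArg (fun y => coeff y p) h0
      simp only [coeff_add, coeff_smul, coeff_mono_self, mul_one, hNp, add_zero, coeff_zero] at h1
      exact hxp.1 h1
    have htips : ∀ p, p ∈ tips lt (I : Set (PathAlgebra K V)) ↔ ∃ t ∈ T, IsSubpath t p :=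
      fun p => ⟨fun hp => not_mem_nontips_iff.1 (htipsT p hp),
        fun hp => hTtips p (not_mem_nontips_iff.2 hp)⟩
    have hcompl : (tips lt (I : Set (PathAlgebra K V)))ᶜ = nontips T := by
      ext p
      rw [Set.mem_compl_iff, htips, ← not_mem_nontips_iff, not_not]
    refine ⟨T, ⟨?_, ?_⟩, ?_⟩
    · refine le_antisymm (monomialIdeal_le_iff.2 fun t ht => ⟨t, (htips t).2 ⟨t, ht, .refl t⟩,
        .refl t⟩) (monomialIdeal_le_iff.2 fun p hp => (htips p).1 hp)
    · intro S hS t ht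
      obtain ⟨s, hs, hst⟩ := monomialIdeal_le_iff.1 hS.ge t ((htips t).2 ⟨t, ht, .refl t⟩)
      obtain ⟨p, hp, hps⟩ := monomialIdeal_le_iff.1 hS.le s hs
      obtain ⟨t', ht', htp⟩ := (htips p).1 hp
      have h1 := htp.trans hps
      have h2 : t' = t := by_contra fun hne => hred t' ht' t ht hne (h1.trans hst)
      subst h2
      rwa [h1.antisymm hst]
    · rw [hcompl]
      ext g
      constructor
      · rintro ⟨t, rfl⟩
        refine ⟨hgen t, t, t.2, _, Submodule.span_mono (Set.image_mono fun n hn => hn.1)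
          (mono_sub_tailElement_mem c t), (add_sub_cancel _ _).symm⟩
      · rintro ⟨hg, t, ht, N, hN, hgN⟩
        -- In `g_t - g` the common term `t` cancels, leaving an ideal element supported on `𝒩`.
        refine ⟨⟨t, ht⟩, sub_eq_zero.1 (h _ (TwoSidedIdeal.sub_mem _ (hgen _) hg) ?_)⟩
        refine mem_span_mono.1 ?_
        have h1 : mono K t - tailElement lt T c ⟨t, ht⟩ ∈ Submodule.span K (mono K '' nontips T) :=
          Submodule.span_mono (Set.image_mono fun n hn => hn.1)
            (mono_sub_tailElement_mem c ⟨t, ht⟩)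
        have h2 := Submodule.sub_mem _ hN h1
        convert h2 using 1
        rw [hgN]
        abel

end Variety

/-! ### Base change of the elements `g_t` -/

section BaseChange

variable {V : Type u} [Quiver.{v} V] {lt : QPath V → QPath V → Prop} {R : Type w} [CommRing R]
  {S : Type*} [CommRing S] (φ : R →+* S) {T : Set (QPath V)} (c : CoordIndex lt T → R)

/-- Finiteness matters: a `finsum` with infinite support is 0 by convention, and `φ` may shrink the
support. -/
theorem mapCoeff_tailElement {t : T} (hfin : (nontipsBelow lt T (t : QPath V)).Finite) :
    mapCoeff φ (tailElement lt T c t) = tailElement lt T (fun i => φ (c i)) t := by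
  have := hfin.fintype
  rw [tailElement, tailElement, mapCoeff_sub, mapCoeff_mono, finsum_eq_sum_of_fintype,
    finsum_eq_sum_of_fintype]
  congr 1
  let ψ : PathAlgebra R V →+ PathAlgebra S V :=
    ⟨⟨mapCoeff φ, mapCoeff_zero φ⟩, mapCoeff_add φ⟩
  refine (map_sum ψ _ _).trans (Finset.sum_congr rfl fun n _ => ?_)
  exact mapCoeff_single φ _ _

variable {c}

theorem mapCoeff_mem_sandwichSpan (hN : ∀ t ∈ T, (nontipsBelow lt T t).Finite)
    {P : QPath V → Prop} {x : PathAlgebra R V} (hx : x ∈ sandwichSpan c P) :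
    mapCoeff φ x ∈ sandwichSpan (fun i => φ (c i)) P := by
  induction hx using Submodule.span_induction with
  | mem x hx =>
    obtain ⟨t, r, s, p, h1, h2, rfl⟩ := hx
    rw [mapCoeff_mul, mapCoeff_mul, mapCoeff_mono, mapCoeff_mono,
      mapCoeff_tailElement φ c (hN t t.2)]
    exact sandwich_mem_sandwichSpan h1 h2
  | zero => rw [mapCoeff_zero]; exact Submodule.zero_mem _
  | add x y _ _ h h' => rw [mapCoeff_add]; exact Submodule.add_mem _ h h'
  | smul k x _ h => rw [mapCoeff_smul]; exact Submodule.smul_mem _ _ h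

end BaseChange

/-! ### Overlap relations and reductions -/

section Reduction

variable {V : Type u} [Quiver.{v} V] {lt : QPath V → QPath V → Prop} {R : Type w} [CommRing R]
  {T : Set (QPath V)} (c : CoordIndex lt T → R)

/-- The overlap relation of the elements with tips `t` and `t'`. -/
noncomputable def overlap (t t' : T) (m n : QPath V) : PathAlgebra R V :=
  tailElement lt T c t * mono R m - mono R n * tailElement lt T c t'

variable (hlt : IsAdmissibleOrder lt)
include hlt

theorem isOverlapRelation_iff [Nontrivial R] {t t' : T} {m n : QPath V} {o : PathAlgebra R V} :
    IsOverlapRelation lt (tailElement lt T c t) (tailElement lt T c t') m n o ↔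
      (∃ z, IsComp t m z ∧ IsComp n t' z ∧ 1 ≤ n.length ∧ 1 ≤ m.length ∧
        m.length < (t' : QPath V).length) ∧ o = overlap c t t' m n := by
  constructor
  · rintro ⟨t₁, t₁', z, h1, h2, h3, h4, h5, h6, h7, rfl⟩
    obtain rfl := hlt.isTip_unique h1 (isTip_tailElement c hlt t)
    obtain rfl := hlt.isTip_unique h2 (isTip_tailElement c hlt t')
    refine ⟨⟨z, h3, h4, h5, h6, h7⟩, ?_⟩
    rw [coeff_tailElement_self c hlt, coeff_tailElement_self c hlt, one_smul, one_smul, overlap]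
  · rintro ⟨⟨z, h3, h4, h5, h6, h7⟩, rfl⟩
    refine ⟨t, t', z, isTip_tailElement c hlt t, isTip_tailElement c hlt t', h3, h4, h5, h6, h7, ?_⟩
    rw [coeff_tailElement_self c hlt, coeff_tailElement_self c hlt, one_smul, one_smul, overlap]

/-- Both products have leading term `z` with coefficient 1. These cancel, and only multiples of the
tails remain. -/
theorem lt_of_coeff_overlap_ne_zero {t t' : T} {m n z : QPath V} (h : IsComp t m z)
    (h' : IsComp n t' z) {p : QPath V} (hp : coeff (overlap c t t' m n) p ≠ 0) : lt p z := by
  have h1 : (mono R (t : QPath V) - tailElement lt T c t) * mono R m ∈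
      Submodule.span R (mono R '' {q | lt q z}) := by
    refine Submodule.span_induction (p := fun y _ => y * mono R m ∈
      Submodule.span R (mono R '' {q | lt q z})) ?_ ?_ ?_ ?_ (mono_sub_tailElement_mem c t)
    · rintro _ ⟨q, hq, rfl⟩
      obtain ⟨w, hw⟩ := IsComp.exists_of_eq (p := q) (q := m) (hq.2.1.2.trans h.tgt_eq_src)
      rw [mono_mul_of_isComp hw]
      exact Submodule.subset_span ⟨w, hlt.mul_right _ _ _ _ _ hq.2.2 h hw, rfl⟩
    · rw [zero_mul]
      exact Submodule.zero_mem _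
    · intro x y _ _ hx hy
      rw [add_mul]
      exact Submodule.add_mem _ hx hy
    · intro a x _ hx
      rw [smul_mul_assoc]
      exact Submodule.smul_mem _ a hx
  have h2 : mono R n * (mono R (t' : QPath V) - tailElement lt T c t') ∈
      Submodule.span R (mono R '' {q | lt q z}) := by
    refine Submodule.span_induction (p := fun y _ => mono R n * y ∈
      Submodule.span R (mono R '' {q | lt q z})) ?_ ?_ ?_ ?_ (mono_sub_tailElement_mem c t')
    · rintro _ ⟨q, hq, rfl⟩
      obtain ⟨w, hw⟩ := IsComp.exists_of_eq (p := n) (q := q) (h'.tgt_eq_src.trans hq.2.1.1.symm)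
      rw [mono_mul_of_isComp hw]
      exact Submodule.subset_span ⟨w, hlt.mul_left _ _ _ _ _ hq.2.2 h' hw, rfl⟩
    · rw [mul_zero]
      exact Submodule.zero_mem _
    · intro x y _ _ hx hy
      rw [mul_add]
      exact Submodule.add_mem _ hx hy
    · intro a x _ hx
      rw [mul_smul_comm]
      exact Submodule.smul_mem _ a hx
  refine (mem_span_mono (S := {q | lt q z})).1 ?_ p hp
  convert Submodule.sub_mem _ h2 h1 using 1
  rw [mul_sub, sub_mul, mono_mul_of_isComp h, mono_mul_of_isComp h', overlap]
  abel

theorem simpleReduction_iff [Nontrivial R] {x y : PathAlgebra R V} :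
    SimpleReduction lt (Set.range (tailElement lt T c)) x y ↔ ∃ (t : T) (r s p : QPath V),
      IsComp₃ r t s p ∧ coeff x p ≠ 0 ∧
        y = x - coeff x p • (mono R r * tailElement lt T c t * mono R s) := by
  constructor
  · rintro ⟨_, ⟨t, rfl⟩, t', r, s, p, h1, h2, h3, rfl⟩
    obtain rfl := hlt.isTip_unique h1 (isTip_tailElement c hlt t)
    exact ⟨t, r, s, p, h2, h3, by rw [coeff_tailElement_self c hlt, one_smul]⟩
  · rintro ⟨t, r, s, p, h2, h3, rfl⟩
    exact ⟨_, ⟨t, rfl⟩, t, r, s, p, isTip_tailElement c hlt t, h2, h3, by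
      rw [coeff_tailElement_self c hlt, one_smul]⟩

theorem irreducible_iff [Nontrivial R] {x : PathAlgebra R V} :
    (∀ z, ¬ SimpleReduction lt (Set.range (tailElement lt T c)) x z) ↔
      ∀ p, coeff x p ≠ 0 → p ∈ nontips T := by
  constructor
  · rintro h p hp t ht ⟨r, s, hrs⟩
    exact h _ ((simpleReduction_iff c hlt).2 ⟨⟨t, ht⟩, r, s, p, hrs, hp, rfl⟩)
  · intro h z hz
    obtain ⟨t, r, s, p, hrs, hp, -⟩ := (simpleReduction_iff c hlt).1 hz
    exact h p hp t t.2 ⟨r, s, hrs⟩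

theorem mem_nontips_of_completeReduction [Nontrivial R] {x y : PathAlgebra R V}
    (h : CompleteReduction lt (Set.range (tailElement lt T c)) x y) {p : QPath V}
    (hp : coeff y p ≠ 0) : p ∈ nontips T := by
  rcases h.2 with rfl | h
  · exact absurd rfl hp
  · exact (irreducible_iff c hlt).1 h p hp

/-- Reducing at the largest reducible path in the support introduces only smaller paths, so the
well-order forces termination. -/
theorem exists_completeReduction [Nontrivial R] (x : PathAlgebra R V) :
    ∃ y, CompleteReduction lt (Set.range (tailElement lt T c)) x y := by
  have step : ∀ x : PathAlgebra R V, (∀ p, coeff x p ≠ 0 → p ∉ nontips T →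
      (∀ q, coeff x q ≠ 0 → q ∉ nontips T → q = p ∨ lt q p) →
      ∃ y, CompleteReduction lt (Set.range (tailElement lt T c)) x y) →
      ∃ y, CompleteReduction lt (Set.range (tailElement lt T c)) x y := by
    intro x hx
    by_cases h : {p | coeff x p ≠ 0 ∧ p ∉ nontips T}.Nonempty
    · obtain ⟨p, hp, hmax⟩ := hlt.exists_max
        ((finite_coeff_ne_zero x).subset fun p hp => hp.1) h
      exact hx p hp.1 hp.2 fun q hq hq' => hmax q ⟨hq, hq'⟩
    · exact ⟨x, .refl, Or.inr ((irreducible_iff c hlt).2 fun p hp =>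
        by_contra fun hp' => h ⟨p, hp, hp'⟩)⟩
  refine step x fun p hp hpN hmax => ?_
  -- From here `p` is only an upper bound for the reducible paths of `x`.
  clear hp hpN
  induction p using hlt.wf.induction generalizing x with
  | _ p ih =>
    by_cases hp : coeff x p ≠ 0 ∧ p ∉ nontips T
    · obtain ⟨t, ht, r, s, hrs⟩ := not_mem_nontips_iff.1 hp.2
      set g := mono R r * tailElement lt T c ⟨t, ht⟩ * mono R s with hg
      have hred : SimpleReduction lt (Set.range (tailElement lt T c)) x (x - coeff x p • g) :=
        (simpleReduction_iff c hlt).2 ⟨⟨t, ht⟩, r, s, p, hrs, hp.1, rfl⟩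
      have hy : ∀ q, coeff (x - coeff x p • g) q ≠ 0 → q ∉ nontips T → lt q p := by
        intro q hq hqN
        by_cases hqp : q = p
        · subst hqp
          refine absurd ?_ hq
          rw [coeff_sub, coeff_smul, hg, coeff_sandwich hrs,
            coeff_tailElement_self c hlt ⟨t, ht⟩, mul_one, sub_self]
        · by_cases hxq : coeff x q = 0
          · rw [coeff_sub, coeff_smul, hxq, zero_sub] at hq
            obtain ⟨q', h1, h2⟩ :=
              exists_of_coeff_sandwich_ne_zero (right_ne_zero_of_mul (neg_ne_zero.1 hq))
            rcases coeff_tailElement_ne_zero c h2 with rfl | h2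
            · exact absurd (h1.unique hrs) hqp
            · exact hlt.isComp₃ h2.2.2 hrs h1
          · exact (hmax q hxq hqN).resolve_left hqp
      obtain ⟨y, h1, h2⟩ := step (x - coeff x p • g) fun q hq hqN hmax' =>
        ih q (hy q hq hqN) _ hmax'
      exact ⟨y, .head hred h1, h2⟩
    · refine step x fun q hq hqN hmax' => ih q ?_ x hmax'
      refine (hmax q hq hqN).resolve_left ?_
      rintro rfl
      exact hp ⟨hq, hqN⟩

/-- Reductions of an element with coefficients in a subring, by elements with coordinates in the
subring, stay in the subring. -/
theorem exists_lift_of_reduction {S : Type*} [CommRing S] [Nontrivial S] (φ : R →+* S)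
    (hN : ∀ t ∈ T, (nontipsBelow lt T t).Finite) {x : PathAlgebra R V} {z : QPath V}
    (hx : ∀ p, coeff x p ≠ 0 → lt p z) {y : PathAlgebra S V}
    (h : Relation.ReflTransGen
      (SimpleReduction lt (Set.range (tailElement lt T fun i => φ (c i)))) (mapCoeff φ x) y) :
    ∃ f, mapCoeff φ f = y ∧ x - f ∈ sandwichSpan c (lt · z) := by
  induction h with
  | refl => exact ⟨x, rfl, by rw [sub_self]; exact Submodule.zero_mem _⟩
  | tail _ h ih =>
    obtain ⟨f, rfl, hf⟩ := ih
    obtain ⟨t, r, s, p, hrs, hp, rfl⟩ := (simpleReduction_iff _ hlt).1 h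
    -- The tip coefficient is 1, so the same subtraction makes sense over `R`, without denominators.
    refine ⟨f - coeff f p • (mono R r * tailElement lt T c t * mono R s), ?_, ?_⟩
    · rw [mapCoeff_sub, mapCoeff_smul, mapCoeff_mul, mapCoeff_mul, mapCoeff_mono, mapCoeff_mono,
        mapCoeff_tailElement φ c (hN t t.2), coeff_mapCoeff]
    · have hfp : coeff f p ≠ 0 := by
        intro h0
        rw [coeff_mapCoeff, h0, map_zero] at hp
        exact hp rfl
      -- A path occurring in `f` occurs in `x` or in `x - f`, and both are supported below `z`.
      have hpz : lt p z := by
        by_cases hxp : coeff x p = 0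
        · refine lt_of_mem_sandwichSpan hlt hf (p := p) ?_
          rw [coeff_sub, hxp, zero_sub]
          exact neg_ne_zero.2 hfp
        · exact hx p hxp
      rw [sub_sub_eq_add_sub, add_sub_right_comm]
      exact Submodule.add_mem _ hf (Submodule.smul_mem _ _ (sandwich_mem_sandwichSpan hrs hpz))

end Reduction

theorem mapCoeff_overlap {V : Type u} [Quiver.{v} V] {lt : QPath V → QPath V → Prop} {R : Type w}
    [CommRing R] {S : Type*} [CommRing S] (φ : R →+* S) {T : Set (QPath V)}
    (c : CoordIndex lt T → R) (hN : ∀ t ∈ T, (nontipsBelow lt T t).Finite) (t t' : T)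
    (m n : QPath V) :
    mapCoeff φ (overlap c t t' m n) = overlap (fun i => φ (c i)) t t' m n := by
  rw [overlap, overlap, mapCoeff_sub, mapCoeff_mul, mapCoeff_mul, mapCoeff_mono, mapCoeff_mono,
    mapCoeff_tailElement φ c (hN t t.2), mapCoeff_tailElement φ c (hN t' t'.2)]

theorem overlap_mem_span {V : Type u} [Quiver.{v} V] {lt : QPath V → QPath V → Prop} {R : Type w}
    [CommRing R] {T : Set (QPath V)} (c : CoordIndex lt T → R) (t t' : T) (m n : QPath V) :
    overlap c t t' m n ∈ TwoSidedIdeal.span (Set.range (tailElement lt T c)) :=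
  TwoSidedIdeal.sub_mem _ (TwoSidedIdeal.mul_mem_right _ _ _ (TwoSidedIdeal.subset_span ⟨t, rfl⟩))
    (TwoSidedIdeal.mul_mem_left _ _ _ (TwoSidedIdeal.subset_span ⟨t', rfl⟩))

/-! ### Generic remainders and their specialization -/

section Generic

variable {K : Type w} [Field K] {V : Type u} [Quiver.{v} V] {lt : QPath V → QPath V → Prop}
  (hlt : IsAdmissibleOrder lt) {T : Set (QPath V)} (hN : ∀ t ∈ T, (nontipsBelow lt T t).Finite)
include hlt hN

theorem exists_lift_of_completeReduction_overlap {t t' : T} {m n z : QPath V}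
    (h : IsComp t m z) (h' : IsComp n t' z) {s : PathAlgebra (CoordField lt K T) V}
    (hs : CompleteReduction lt (Set.range (genericElement lt K T))
      (overlap (fun i => algebraMap (CoordRing lt K T) (CoordField lt K T) (MvPolynomial.X i))
        t t' m n) s) :
    ∃ f : PathAlgebra (CoordRing lt K T) V, mapCoeff (algebraMap _ _) f = s ∧
      overlap MvPolynomial.X t t' m n - f ∈ sandwichSpan MvPolynomial.X (lt · z) := by
  refine exists_lift_of_reduction MvPolynomial.X hlt _ hN
    (fun p hp => lt_of_coeff_overlap_ne_zero _ hlt h h' hp) ?_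
  rw [mapCoeff_overlap _ _ hN]
  exact hs.1

/-- The specialization of a complete reduction of a generic overlap relation is supported outside
the ideal generated by `T`, and congruent to the specialized overlap relation. -/
theorem specialize_completeReduction {t t' : T} {m n z : QPath V}
    (h : IsComp t m z) (h' : IsComp n t' z) {f : PathAlgebra (CoordRing lt K T) V}
    (hs : CompleteReduction lt (Set.range (genericElement lt K T))
      (overlap (fun i => algebraMap (CoordRing lt K T) (CoordField lt K T) (MvPolynomial.X i))
        t t' m n) (mapCoeff (algebraMap _ _) f)) (c : CoordIndex lt T → K) :
    overlap c t t' m n - mapCoeff (MvPolynomial.eval c) f ∈ sandwichSpan c (lt · z) ∧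
      ∀ b, coeff (mapCoeff (MvPolynomial.eval c) f) b ≠ 0 → b ∈ nontips T := by
  constructor
  · obtain ⟨f', hf', hmem⟩ := exists_lift_of_completeReduction_overlap hlt hN h h' hs
    -- The polynomial ring embeds in its fraction field, so the given `f` is the lift carrying the
    -- span membership.
    obtain rfl := mapCoeff_injective _ (IsFractionRing.injective _ _) hf'
    have := mapCoeff_mem_sandwichSpan (MvPolynomial.eval c) hN hmem
    rw [mapCoeff_sub, mapCoeff_overlap _ _ hN] at this
    simpa only [MvPolynomial.eval_X] using this
  · intro b hb
    refine mem_nontips_of_completeReduction _ hlt hs (p := b) fun h0 => hb ?_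
    rw [coeff_mapCoeff] at h0 ⊢
    rw [(map_eq_zero_iff _ (IsFractionRing.injective _ _)).1 h0, map_zero]

/-- At a point of the variety, each specialized remainder is an ideal element supported on `𝒩`,
hence zero. Conversely, vanishing remainders place every overlap in the span below its common
multiple, and the diamond lemma applies. -/
theorem varietyOf_eq_zeroLocus (hred : IsTipReduced T)
    (f : T → T → QPath V → QPath V → PathAlgebra (CoordRing lt K T) V)
    (hf : ∀ (t t' : T) (m n : QPath V) (o : PathAlgebra (CoordField lt K T) V),
      IsOverlapRelation lt (genericElement lt K T t) (genericElement lt K T t') m n o →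
      CompleteReduction lt (Set.range (genericElement lt K T)) o
        (mapCoeff (algebraMap _ _) (f t t' m n))) :
    varietyOf lt K T =
      {c | ∀ (t t' : T) (m n : QPath V) (o : PathAlgebra (CoordField lt K T) V),
        IsOverlapRelation lt (genericElement lt K T t) (genericElement lt K T t') m n o →
        ∀ b ∈ nontips T, MvPolynomial.eval c (coeff (f t t' m n) b) = 0} := by
  ext c
  constructor
  · intro hc t t' m n o ho b _
    have hs := hf t t' m n o ho
    obtain ⟨⟨z, h, h', -⟩, rfl⟩ := (isOverlapRelation_iff _ hlt).1 ho
    obtain ⟨h1, h2⟩ := specialize_completeReduction hlt hN h h' hs c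
    have h3 := mem_span_range_tailElement_iff.2 (sandwichSpan_mono (fun _ _ => trivial) h1)
    have h4 := TwoSidedIdeal.sub_mem _ (overlap_mem_span c t t' m n) h3
    rw [sub_sub_cancel] at h4
    have h5 := (mem_varietyOf_iff hlt hred c).1 hc _ h4 h2
    rw [← coeff_mapCoeff, h5, coeff_zero]
  · intro hc
    refine (mem_varietyOf_iff hlt hred c).2 fun x hx hxN =>
      eq_zero_of_mem_span_of_overlapsResolvable hlt hred ?_ hx hxN
    intro t t' m n z h h' hn hm hm'
    have ho := (isOverlapRelation_iff
      (fun i => algebraMap (CoordRing lt K T) (CoordField lt K T) (MvPolynomial.X i)) hlt).2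
      ⟨⟨z, h, h', hn, hm, hm'⟩, rfl⟩
    obtain ⟨h1, h2⟩ := specialize_completeReduction hlt hN h h' (hf t t' m n _ ho) c
    have h3 : mapCoeff (MvPolynomial.eval c) (f t t' m n) = 0 := by
      refine ext_coeff fun b => by_contra fun hb => hb ?_
      exact hc t t' m n _ ho b (h2 b hb)
    rwa [h3, sub_zero] at h1

end Generic

/-- The common zero set of any set of polynomials in finitely many variables is an affine
variety. -/
theorem isAffineVariety_zeroLocus {K : Type*} [Field K] {σ : Type*} [Finite σ]
    (A : Set (MvPolynomial σ K)) :
    IsAffineVariety {c : σ → K | ∀ f ∈ A, MvPolynomial.eval c f = 0} := by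
  refine ⟨inferInstance, ?_⟩
  -- Hilbert's basis theorem; zero sets depend only on the generated ideal.
  obtain ⟨S, hS⟩ := IsNoetherian.noetherian (Ideal.span A)
  refine ⟨S, ?_⟩
  have key : ∀ (B : Set (MvPolynomial σ K)) (c : σ → K),
      (∀ f ∈ B, MvPolynomial.eval c f = 0) ↔ Ideal.span B ≤ RingHom.ker (MvPolynomial.eval c) :=
    fun B c => Iff.symm (Ideal.span_le (I := RingHom.ker (MvPolynomial.eval c)))
  ext c
  exact (key A c).trans (by rw [← hS]; exact (key S c).symm)

end QuiverVariety

/-! ### The main theorem -/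

open QuiverVariety PathAlgebra
theorem mainTheorem3 {K : Type*} [Field K] {V : Type*} [Quiver V]
    (lt : QPath V → QPath V → Prop) (hlt : IsAdmissibleOrder lt)
    (T : Set (QPath V)) (hT : T.Finite) (hlen : ∀ t ∈ T, 2 ≤ t.length) (hred : IsTipReduced T)
    (hN : ∀ t ∈ T, (nontipsBelow lt T t).Finite) :
    IsAffineVariety (varietyOf lt K T) ∧
    -- every overlap relation of the generic elements has a complete reduction,
    (∀ (t t' : T) (m n : QPath V) (o : PathAlgebra (CoordField lt K T) V),
      IsOverlapRelation lt (genericElement lt K T t) (genericElement lt K T t') m n o →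
      ∃ s, CompleteReduction lt (Set.range (genericElement lt K T)) o s) ∧
    -- each of them is a combination of paths in `𝒩` with polynomial coefficients,
    (∀ (t t' : T) (m n : QPath V) (o s : PathAlgebra (CoordField lt K T) V),
      IsOverlapRelation lt (genericElement lt K T t) (genericElement lt K T t') m n o →
      CompleteReduction lt (Set.range (genericElement lt K T)) o s →
      (∀ b, coeff s b ≠ 0 → b ∈ nontips T) ∧
      ∃ f : PathAlgebra (CoordRing lt K T) V, mapCoeff (algebraMap _ _) f = s) ∧
    -- and for every choice `f` of complete reductions of all overlap relations, the coefficients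
    -- of `f` cut out the set.
    (∀ f : T → T → QPath V → QPath V → PathAlgebra (CoordRing lt K T) V,
      (∀ (t t' : T) (m n : QPath V) (o : PathAlgebra (CoordField lt K T) V),
        IsOverlapRelation lt (genericElement lt K T t) (genericElement lt K T t') m n o →
        CompleteReduction lt (Set.range (genericElement lt K T)) o
          (mapCoeff (algebraMap _ _) (f t t' m n))) →
      varietyOf lt K T =
        {c | ∀ (t t' : T) (m n : QPath V) (o : PathAlgebra (CoordField lt K T) V),
          IsOverlapRelation lt (genericElement lt K T t) (genericElement lt K T t') m n o →
          ∀ b ∈ nontips T, MvPolynomial.eval c (coeff (f t t' m n) b) = 0}) := by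
  have exist : ∀ (t t' : T) (m n : QPath V) (o : PathAlgebra (CoordField lt K T) V),
      IsOverlapRelation lt (genericElement lt K T t) (genericElement lt K T t') m n o →
      ∃ s, CompleteReduction lt (Set.range (genericElement lt K T)) o s :=
    fun t t' m n o _ => exists_completeReduction _ hlt o
  have lift : ∀ (t t' : T) (m n : QPath V) (o s : PathAlgebra (CoordField lt K T) V),
      IsOverlapRelation lt (genericElement lt K T t) (genericElement lt K T t') m n o →
      CompleteReduction lt (Set.range (genericElement lt K T)) o s →
      (∀ b, coeff s b ≠ 0 → b ∈ nontips T) ∧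
      ∃ f : PathAlgebra (CoordRing lt K T) V, mapCoeff (algebraMap _ _) f = s := by
    intro t t' m n o s ho hs
    refine ⟨fun b hb => mem_nontips_of_completeReduction _ hlt hs hb, ?_⟩
    obtain ⟨⟨z, h, h', -⟩, rfl⟩ := (isOverlapRelation_iff _ hlt).1 ho
    obtain ⟨f, hf, -⟩ := exists_lift_of_completeReduction_overlap hlt hN h h' hs
    exact ⟨f, hf⟩
  refine ⟨?_, exist, lift, fun f hf => varietyOf_eq_zeroLocus hlt hN hred f hf⟩
  -- The overlap relation is determined by `t`, `t'`, `m`, `n`, so one polynomial remainder serves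
  -- every `o`; where there is no overlap, 0 is a dummy value.
  have choice : ∀ (t t' : T) (m n : QPath V), ∃ f : PathAlgebra (CoordRing lt K T) V,
      ∀ o, IsOverlapRelation lt (genericElement lt K T t) (genericElement lt K T t') m n o →
        CompleteReduction lt (Set.range (genericElement lt K T)) o
          (mapCoeff (algebraMap _ _) f) := by
    intro t t' m n
    by_cases h : ∃ o, IsOverlapRelation lt (genericElement lt K T t) (genericElement lt K T t')
        m n o
    · obtain ⟨o, ho⟩ := h
      obtain ⟨s, hs⟩ := exist t t' m n o ho
      obtain ⟨-, f, rfl⟩ := lift t t' m n o s ho hs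
      refine ⟨f, fun o' ho' => ?_⟩
      rwa [((isOverlapRelation_iff _ hlt).1 ho').2, ← ((isOverlapRelation_iff _ hlt).1 ho).2]
    · exact ⟨0, fun o ho => absurd ⟨o, ho⟩ h⟩
  choose f hf using choice
  have : Finite T := hT
  have (t : T) : Finite (nontipsBelow lt T (t : QPath V)) := hN t t.2
  rw [varietyOf_eq_zeroLocus hlt hN hred f hf]
  convert isAffineVariety_zeroLocus {g : CoordRing lt K T |
    ∃ (t t' : T) (m n : QPath V) (o : PathAlgebra (CoordField lt K T) V),
      IsOverlapRelation lt (genericElement lt K T t) (genericElement lt K T t') m n o ∧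
      ∃ b ∈ nontips T, g = coeff (f t t' m n) b} using 1
  ext c
  constructor
  · rintro h _ ⟨t, t', m, n, o, ho, b, hb, rfl⟩
    exact h t t' m n o ho b hb
  · intro h t t' m n o ho b hb
    exact h _ ⟨t, t', m, n, o, ho, b, hb, rfl⟩
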